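/- For an open set $U\subset\mathbb C^n$ and $1\le p<\infty$ let $\mathcal{O}L^p(U)$ be the set of holomorphic functions $f:U\to\mathbb C$ with $\|f\|_p=\left(\int_U|f|^p\,dv\right)^{1/p}<\infty$, where $dv$ is Lebesgue measure, and let $\mathcal{O}L^\infty(U)$ be the set of bounded holomorphic functions on $U$. Let $1<q\le\infty$, and let $\Omega$ be the open unit ball of $\mathbb C^n$ or, more generally, an ellipsoid $$\Omega=\Big\{z\in\mathbb C^n:\ \frac{|z_1|^2}{a_1^2}+\dots+\frac{|z_n|^2}{a_n^2}<1\Big\},\qquad a_1,\dots,a_n>0 .$$ The space $\bigcap_{p<q}\mathcal{O}L^p(\Omega)$ (intersection over $1\le p<q$) is endowed with the metric $$d(f,g)=\sum_{j=1}^\infty\frac1{2^j}\,\frac{\|f-g\|_{p_j}}{1+\|f-g\|_{p_j}},$$ where $1<p_1<p_2<\cdots<q$ is any sequence with $p_j\to q$. A holomorphic function $g$ on $\Omega$ is called totally unbounded in $\Omega$ if, for every $w\in\partial\Omega$, every $\delta>0$ and every connected component $E$ of $B(w,\delta)\cap\Omega$, one has $\sup_E|g|=\infty$, where $B(w,\delta)=\{z:|z-w|<\delta\}$.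 Then the set $$\Big\{g\in\bigcap_{p<q}\mathcal{O}L^p(\Omega):\ g\text{ is totally unbounded in }\Omega\text{ and } g\notin\mathcal{O}L^q(B(\zeta,\varepsilon)\cap\Omega)\text{ for all }\zeta\in\partial\Omega\text{ and all }\varepsilon>0\Big\}$$ is a dense $G_\delta$ subset of the space $\bigcap_{p<q}\mathcal{O}L^p(\Omega)$. -/

import Mathlib

open MeasureTheory Filter Topology TopologicalSpace
open scoped ENNReal

/-- `ℂⁿ` with its Euclidean norm; `volume` on it is Lebesgue measure on `ℂⁿ = ℝ²ⁿ`. -/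
abbrev Cn (n : ℕ) : Type := EuclideanSpace ℂ (Fin n)

/-- The open unit ball of `ℂⁿ`. -/
def unitBall (n : ℕ) : Opens (Cn n) := ⟨Metric.ball 0 1, Metric.isOpen_ball⟩

/-- The ellipsoid `∑ |z_j|² / a_j² < 1`. -/
def ellipsoid {n : ℕ} (a : Fin n → ℝ) : Opens (Cn n) :=
  ⟨{z | ∑ j, ‖z j‖ ^ 2 / a j ^ 2 < 1},
    isOpen_lt (continuous_finsetSum _ fun j _ =>
      ((by fun_prop : Continuous fun z : Cn n => ‖z j‖ ^ 2)).div_const _) continuous_const⟩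

/-- The norm `‖f‖_p` on `U`, as an extended real: `(∫_U |f|^p dv)^(1/p)` for `p < ∞`, and
`sup_U |f|` for `p = ∞`. -/
noncomputable def olNorm {n : ℕ} (p : ℝ≥0∞) (U : Set (Cn n)) (f : Cn n → ℂ) : ℝ≥0∞ :=
  if p = ∞ then ⨆ z ∈ U, ‖f z‖ₑ
  else (∫⁻ z in U, ‖f z‖ₑ ^ p.toReal) ^ (1 / p.toReal)

/-- `f ∈ OL^p(U)`: the function `f` is holomorphic on `U` with `‖f‖_p < ∞`. -/
def MemOL {n : ℕ} (p : ℝ≥0∞) (U : Set (Cn n)) (f : Cn n → ℂ) : Prop :=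
  DifferentiableOn ℂ f U ∧ olNorm p U f < ∞

/-- The space `⋂_{p < q} OL^p(Ω)`, the exponents `p` being `≥ 1`. A function `Ω → ℂ` is
represented by its extension by zero to `ℂⁿ`. -/
def BergmanInter {n : ℕ} (Ω : Opens (Cn n)) (q : ℝ≥0∞) : Type :=
  {f : Cn n → ℂ // (∀ z, z ∉ Ω → f z = 0) ∧ ∀ p : ℝ≥0∞, 1 ≤ p → p < q → MemOL p Ω f}

/-- A sequence of exponents `1 < p₀ < p₁ < ⋯ < q` with `p_j → q`. -/
structure IsExponentSeq (q : ℝ≥0∞) (p : ℕ → ℝ≥0∞) : Prop where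
  one_lt : ∀ j, 1 < p j
  lt : ∀ j, p j < q
  strictMono : StrictMono p
  tendsto : Tendsto p atTop (𝓝 q)

/-- `‖f - g‖_p / (1 + ‖f - g‖_p)`. -/
noncomputable def bergmanTerm {n : ℕ} (Ω : Opens (Cn n)) (p : ℝ≥0∞) (f g : Cn n → ℂ) : ℝ :=
  (olNorm p Ω (f - g)).toReal / (1 + (olNorm p Ω (f - g)).toReal)

/-- `d(f, g) = ∑ 2^{-j} ‖f - g‖_{p_j} / (1 + ‖f - g‖_{p_j})`; the index here starts at `0`. -/
noncomputable def bergmanDist {n : ℕ} (Ω : Opens (Cn n)) (p : ℕ → ℝ≥0∞) (f g : Cn n → ℂ) : ℝ :=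
  ∑' j : ℕ, (1 / 2 : ℝ) ^ (j + 1) * bergmanTerm Ω (p j) f g

theorem bergmanTerm_nonneg {n : ℕ} (Ω : Opens (Cn n)) (p : ℝ≥0∞) (f g : Cn n → ℂ) :
    0 ≤ bergmanTerm Ω p f g := by
  unfold bergmanTerm; positivity

theorem bergmanDist_summable {n : ℕ} (Ω : Opens (Cn n)) (p : ℕ → ℝ≥0∞) (f g : Cn n → ℂ) :
    Summable fun j : ℕ => (1 / 2 : ℝ) ^ (j + 1) * bergmanTerm Ω (p j) f g := by
  have h2 : Summable fun j : ℕ => (1 / 2 : ℝ) ^ (j + 1) :=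
    (summable_nat_add_iff 1).2 summable_geometric_two
  refine Summable.of_nonneg_of_le (fun j => mul_nonneg (by positivity)
    (bergmanTerm_nonneg ..)) (fun j => mul_le_of_le_one_right (by positivity) ?_) h2
  unfold bergmanTerm
  rw [div_le_one (by positivity)]
  linarith

theorem olNorm_eq_eLpNorm {n : ℕ} {p : ℝ≥0∞} (h0 : p ≠ 0) (hp : p ≠ ∞) (U : Set (Cn n))
    (f : Cn n → ℂ) : olNorm p U f = eLpNorm f p (volume.restrict U) := by
  rw [olNorm, if_neg hp, eLpNorm_eq_lintegral_rpow_enorm_toReal h0 hp]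

namespace BergmanInter

variable {n : ℕ} {Ω : Opens (Cn n)} {q : ℝ≥0∞}

theorem aesm (f : BergmanInter Ω q) (hq : 1 < q) :
    AEStronglyMeasurable f.1 (volume.restrict (Ω : Set (Cn n))) :=
  (f.2.2 1 le_rfl hq).1.continuousOn.aestronglyMeasurable Ω.isOpen.measurableSet

theorem memLp (f : BergmanInter Ω q) {p : ℝ≥0∞} (h1 : 1 ≤ p) (hp : p < q) :
    MemLp f.1 p (volume.restrict (Ω : Set (Cn n))) :=
  ⟨f.aesm (h1.trans_lt hp), by
    rw [← olNorm_eq_eLpNorm (by positivity) (hp.trans_le le_top).ne]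
    exact (f.2.2 p h1 hp).2⟩

theorem term_triangle (f g h : BergmanInter Ω q) {p : ℝ≥0∞} (h1 : 1 ≤ p) (hp : p < q) :
    bergmanTerm Ω p f.1 h.1 ≤ bergmanTerm Ω p f.1 g.1 + bergmanTerm Ω p g.1 h.1 := by
  have hp' : p ≠ ∞ := (hp.trans_le le_top).ne
  have h0 : p ≠ 0 := by positivity
  simp only [bergmanTerm, olNorm_eq_eLpNorm h0 hp']
  have hfg := (f.memLp h1 hp).sub (g.memLp h1 hp)
  have hgh := (g.memLp h1 hp).sub (h.memLp h1 hp)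
  have key : (eLpNorm (f.1 - h.1) p (volume.restrict (Ω : Set (Cn n)))).toReal ≤
      (eLpNorm (f.1 - g.1) p (volume.restrict (Ω : Set (Cn n)))).toReal +
      (eLpNorm (g.1 - h.1) p (volume.restrict (Ω : Set (Cn n)))).toReal := by
    rw [← ENNReal.toReal_add hfg.2.ne hgh.2.ne]
    refine ENNReal.toReal_mono (ENNReal.add_ne_top.2 ⟨hfg.2.ne, hgh.2.ne⟩) ?_
    have := eLpNorm_add_le hfg.1 hgh.1 h1
    rwa [sub_add_sub_cancel] at this
  set x := (eLpNorm (f.1 - h.1) p (volume.restrict (Ω : Set (Cn n)))).toReal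
  set y := (eLpNorm (f.1 - g.1) p (volume.restrict (Ω : Set (Cn n)))).toReal
  set z := (eLpNorm (g.1 - h.1) p (volume.restrict (Ω : Set (Cn n)))).toReal
  have hx : 0 ≤ x := ENNReal.toReal_nonneg
  have hy : 0 ≤ y := ENNReal.toReal_nonneg
  have hz : 0 ≤ z := ENNReal.toReal_nonneg
  calc x / (1 + x) ≤ (y + z) / (1 + (y + z)) := by
        rw [div_le_div_iff₀ (by positivity) (by positivity)]; nlinarith
    _ = y / (1 + (y + z)) + z / (1 + (y + z)) := add_div ..
    _ ≤ y / (1 + y) + z / (1 + z) := by gcongr <;> linarith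

theorem eq_of_term_eq_zero (f g : BergmanInter Ω q) {p : ℝ≥0∞} (h1 : 1 ≤ p) (hp : p < q)
    (h : bergmanTerm Ω p f.1 g.1 = 0) : f = g := by
  have hp' : p ≠ ∞ := (hp.trans_le le_top).ne
  have h0 : p ≠ 0 := by positivity
  have hfg := (f.memLp h1 hp).sub (g.memLp h1 hp)
  rw [bergmanTerm, olNorm_eq_eLpNorm h0 hp', div_eq_zero_iff] at h
  have hz : eLpNorm (f.1 - g.1) p (volume.restrict (Ω : Set (Cn n))) = 0 := by
    rcases h with h | h
    · exact (ENNReal.toReal_eq_zero_iff _).1 h |>.resolve_right hfg.2.ne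
    · have : (0 : ℝ) ≤ (eLpNorm (f.1 - g.1) p (volume.restrict (Ω : Set (Cn n)))).toReal :=
        ENNReal.toReal_nonneg
      linarith
  rw [eLpNorm_eq_zero_iff hfg.1 h0] at hz
  have hae : f.1 =ᵐ[volume.restrict (Ω : Set (Cn n))] g.1 := by
    filter_upwards [hz] with z hz
    exact sub_eq_zero.1 hz
  have hEq := Measure.eqOn_open_of_ae_eq hae Ω.isOpen (f.2.2 p h1 hp).1.continuousOn
    (g.2.2 p h1 hp).1.continuousOn
  refine Subtype.ext (funext fun z => ?_)
  by_cases hz : z ∈ Ω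
  · exact hEq hz
  · rw [f.2.1 z hz, g.2.1 z hz]

/-- The space `⋂_{p < q} OL^p(Ω)` with the metric `d` of a sequence of exponents. -/
noncomputable abbrev metric (Ω : Opens (Cn n)) {q : ℝ≥0∞} {p : ℕ → ℝ≥0∞}
    (hp : IsExponentSeq q p) : MetricSpace (BergmanInter Ω q) where
  dist f g := bergmanDist Ω p f.1 g.1
  dist_self f := by
    have : ∀ j, bergmanTerm Ω (p j) f.1 f.1 = 0 := fun j => by
      rw [bergmanTerm, olNorm_eq_eLpNorm (zero_lt_one.trans (hp.one_lt j)).ne'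
        ((hp.lt j).trans_le le_top).ne]
      simp
    simp [bergmanDist, this]
  dist_comm f g := by
    have : ∀ j, bergmanTerm Ω (p j) f.1 g.1 = bergmanTerm Ω (p j) g.1 f.1 := fun j => by
      have h0 := (zero_lt_one.trans (hp.one_lt j)).ne'
      have h1 := ((hp.lt j).trans_le le_top).ne
      simp only [bergmanTerm, olNorm_eq_eLpNorm h0 h1, eLpNorm_sub_comm f.1 g.1]
    simp [bergmanDist, this]
  dist_triangle f g h := by
    unfold bergmanDist
    rw [← (bergmanDist_summable ..).tsum_add (bergmanDist_summable ..)]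
    refine (bergmanDist_summable ..).tsum_le_tsum (fun j => ?_)
      ((bergmanDist_summable ..).add (bergmanDist_summable ..))
    rw [← mul_add]
    exact mul_le_mul_of_nonneg_left (term_triangle f g h (hp.one_lt j).le (hp.lt j))
      (by positivity)
  eq_of_dist_eq_zero {f g} h := by
    have hs : HasSum (fun j : ℕ => (1 / 2 : ℝ) ^ (j + 1) * bergmanTerm Ω (p j) f.1 g.1) 0 := by
      have h1 := (bergmanDist_summable Ω p f.1 g.1).hasSum
      rwa [show (∑' j : ℕ, (1 / 2 : ℝ) ^ (j + 1) * bergmanTerm Ω (p j) f.1 g.1) = 0 from h] at h1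
    have hn : ∀ j : ℕ, 0 ≤ (1 / 2 : ℝ) ^ (j + 1) * bergmanTerm Ω (p j) f.1 g.1 := fun j =>
      mul_nonneg (by positivity) (bergmanTerm_nonneg ..)
    have h0 := congrFun ((hasSum_zero_iff_of_nonneg hn).1 hs) 0
    refine eq_of_term_eq_zero f g (hp.one_lt 0).le (hp.lt 0) ?_
    simpa using h0

end BergmanInter

/-- `f` is totally unbounded in `Ω`: it is unbounded on every connected component of
`B(w, δ) ∩ Ω`, for every boundary point `w` and every `δ > 0`. -/
def TotallyUnbounded {n : ℕ} (Ω : Set (Cn n)) (f : Cn n → ℂ) : Prop :=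
  ∀ w ∈ frontier Ω, ∀ δ : ℝ, 0 < δ → ∀ z ∈ Metric.ball w δ ∩ Ω,
    ¬ BddAbove ((fun x => ‖f x‖) '' connectedComponentIn (Metric.ball w δ ∩ Ω) z)

/-- The functions in `⋂_{p < q} OL^p(Ω)` which are totally unbounded in `Ω` and which do not belong
to `OL^q(B(ζ, ε) ∩ Ω)` for any boundary point `ζ` and any `ε > 0`. -/
def unboundedSingularSet {n : ℕ} (Ω : Opens (Cn n)) (q : ℝ≥0∞) : Set (BergmanInter Ω q) :=
  {g | TotallyUnbounded (Ω : Set (Cn n)) g.1 ∧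
    ∀ ζ ∈ frontier (Ω : Set (Cn n)), ∀ ε : ℝ, 0 < ε →
      ¬ MemOL q (Metric.ball ζ ε ∩ (Ω : Set (Cn n))) g.1}

/-! On the unit ball of a complex space of dimension `n`, the kernel `|1 - ⟪ξ, w⟫| ^ (-t)` with `‖ξ‖
= 1` is integrable exactly below the critical exponent `n + 1`. After `y = ξ - w` it becomes `|⟪ξ,
y⟫| ^ (-t)` on the ball about `ξ`. The anisotropic dilation by `r²` along `ξ` and by `r` across it
maps that ball into itself for `0 < r ≤ 1` and scales integrals of the kernel by `r ^ (2 (n + 1 -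
t))`. Below the critical exponent the dilates give a convergent geometric series; at it the integral
is scale invariant, hence infinite.

Hence `φ(1 - ⟪ξ, w⟫)`, with `φ` a power of exponent `-(n + 1) / q`, or a logarithm if `q = ∞`, lies
in every `L^p` with `p < q`, uniformly in `ξ`, but not in `L^q` near `ξ`. Baire's theorem on the
coefficients gives a superposition of such peaks at a dense sequence of sphere points which is
singular at all of them (`exists_differentiableOn_eLpNorm_eq_top`). A linear map carries it to the
ellipsoid.

By convexity each `B(w, δ) ∩ Ω` is connected and of finite measure, so infinite local `L^q` norms
already force total unboundedness. Countably many balls suffice to test these norms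
(`mem_unboundedSingularSet_iff`). By Fatou, bounding a local norm is a closed condition, which gives
the `G_δ`. For density, perturb `f` to `f + η g₀` with `g₀` singular: each ball excludes at most one
`η`, so arbitrarily small good `η` exist. -/

/-! ### Parabolic dilations and the critical exponent of the kernel -/

section ParabolicDilation

open Module
open scoped InnerProductSpace

variable {E : Type*} [NormedAddCommGroup E] [InnerProductSpace ℂ E]

/-- The dilation `y ↦ r y + (r² - r) ⟪ξ, y⟫ ξ`; for a unit vector `ξ` it multiplies `ξ` by `r²` and
the orthogonal complement of `ξ` by `r`. -/
noncomputable def parabolicDilation (ξ : E) (r : ℝ) : E →ₗ[ℂ] E :=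
  (r : ℂ) • LinearMap.transvection (innerₛₗ ℂ ξ) (((r : ℂ) - 1) • ξ)

theorem parabolicDilation_apply (ξ : E) (r : ℝ) (y : E) :
    parabolicDilation ξ r y = (r : ℂ) • y + (((r : ℂ) ^ 2 - r) * ⟪ξ, y⟫_ℂ) • ξ := by
  simp only [parabolicDilation, LinearMap.smul_apply, LinearMap.transvection.apply, innerₛₗ_apply_apply,
    smul_add, smul_smul]
  congr 2
  ring

theorem inner_parabolicDilation {ξ : E} (hξ : ‖ξ‖ = 1) (r : ℝ) (y : E) :
    ⟪ξ, parabolicDilation ξ r y⟫_ℂ = (r : ℂ) ^ 2 * ⟪ξ, y⟫_ℂ := by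
  rw [parabolicDilation_apply, inner_add_right, inner_smul_right, inner_smul_right,
    inner_self_eq_norm_sq_to_K, hξ]
  simp
  ring

theorem parabolicDilation_parabolicDilation {ξ : E} (hξ : ‖ξ‖ = 1) (r s : ℝ) (y : E) :
    parabolicDilation ξ r (parabolicDilation ξ s y) = parabolicDilation ξ (r * s) y := by
  rw [parabolicDilation_apply ξ r, inner_parabolicDilation hξ, parabolicDilation_apply,
    parabolicDilation_apply, smul_add, smul_smul, smul_smul, add_assoc, ← add_smul]
  push_cast
  congr 2
  ring

theorem parabolicDilation_one (ξ y : E) : parabolicDilation ξ 1 y = y := by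
  simp [parabolicDilation_apply]

theorem parabolicDilation_inv_cancel {ξ : E} (hξ : ‖ξ‖ = 1) {r : ℝ} (hr : r ≠ 0) (y : E) :
    parabolicDilation ξ r (parabolicDilation ξ r⁻¹ y) = y := by
  rw [parabolicDilation_parabolicDilation hξ, mul_inv_cancel₀ hr, parabolicDilation_one]

theorem parabolicDilation_injective {ξ : E} (hξ : ‖ξ‖ = 1) {r : ℝ} (hr : r ≠ 0) :
    Function.Injective (parabolicDilation ξ r) := by
  refine Function.LeftInverse.injective (g := parabolicDilation ξ r⁻¹) fun y => ?_
  rw [parabolicDilation_parabolicDilation hξ, inv_mul_cancel₀ hr, parabolicDilation_one]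

theorem norm_parabolicDilation_sq {ξ : E} (hξ : ‖ξ‖ = 1) (r : ℝ) (y : E) :
    ‖parabolicDilation ξ r y‖ ^ 2 = r ^ 2 * ‖y‖ ^ 2 + (r ^ 4 - r ^ 2) * ‖⟪ξ, y⟫_ℂ‖ ^ 2 := by
  rw [parabolicDilation_apply, norm_add_sq (𝕜 := ℂ)]
  have h1 : ⟪(r : ℂ) • y, (((r : ℂ) ^ 2 - r) * ⟪ξ, y⟫_ℂ) • ξ⟫_ℂ =
      ((r * (r ^ 2 - r) * ‖⟪ξ, y⟫_ℂ‖ ^ 2 : ℝ) : ℂ) := by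
    rw [inner_smul_left, inner_smul_right, ← inner_conj_symm y ξ, mul_assoc, Complex.mul_conj,
      Complex.normSq_eq_norm_sq]
    push_cast
    rw [Complex.conj_ofReal]
    ring
  have h2 : ‖(((r : ℂ) ^ 2 - r) * ⟪ξ, y⟫_ℂ) • ξ‖ ^ 2 = (r ^ 2 - r) ^ 2 * ‖⟪ξ, y⟫_ℂ‖ ^ 2 := by
    rw [norm_smul, hξ, norm_mul, mul_one, mul_pow,
      show ((r : ℂ) ^ 2 - r) = ((r ^ 2 - r : ℝ) : ℂ) by push_cast; ring, Complex.norm_real,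
      Real.norm_eq_abs, sq_abs]
  rw [h1, h2, norm_smul, Complex.norm_real, mul_pow, Real.norm_eq_abs, sq_abs]
  simp only [RCLike.re_to_complex, Complex.ofReal_re]
  ring

theorem norm_inner_le_norm_of_unit {ξ : E} (hξ : ‖ξ‖ = 1) (y : E) : ‖⟪ξ, y⟫_ℂ‖ ≤ ‖y‖ := by
  simpa [hξ] using norm_inner_le_norm (𝕜 := ℂ) ξ y

theorem norm_parabolicDilation_le {ξ : E} (hξ : ‖ξ‖ = 1) {r : ℝ} (h0 : 0 ≤ r) (h1 : r ≤ 1) (y : E) :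
    ‖parabolicDilation ξ r y‖ ≤ r * ‖y‖ := by
  refine (sq_le_sq₀ (norm_nonneg _) (by positivity)).1 ?_
  rw [norm_parabolicDilation_sq hξ, mul_pow]
  have : r ^ 4 ≤ r ^ 2 := pow_le_pow_of_le_one h0 h1 (by norm_num)
  nlinarith [mul_nonneg (sub_nonneg.2 this) (sq_nonneg ‖⟪ξ, y⟫_ℂ‖)]

/-- In this form a dilation with `0 < r ≤ 1` multiplies the right side by `r²` and the left side by
at most `r²`. -/
theorem mem_ball_unit_iff {ξ : E} (hξ : ‖ξ‖ = 1) (y : E) :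
    y ∈ Metric.ball ξ 1 ↔ ‖y‖ ^ 2 < 2 * (⟪ξ, y⟫_ℂ).re := by
  rw [mem_ball_iff_norm, ← sq_lt_sq₀ (norm_nonneg _) zero_le_one, norm_sub_sq (𝕜 := ℂ), hξ,
    ← inner_conj_symm]
  simp only [RCLike.re_to_complex, Complex.conj_re]
  constructor <;> intro h <;> linarith

theorem inner_ne_zero_of_mem_ball {ξ : E} (hξ : ‖ξ‖ = 1) {y : E} (hy : y ∈ Metric.ball ξ 1) :
    ⟪ξ, y⟫_ℂ ≠ 0 := by
  intro h
  rw [mem_ball_unit_iff hξ, h] at hy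
  simp at hy
  nlinarith [sq_nonneg ‖y‖]

theorem norm_lt_two_of_mem_ball {F : Type*} [SeminormedAddCommGroup F] {ξ : F} (hξ : ‖ξ‖ = 1) {y : F}
    (hy : y ∈ Metric.ball ξ 1) :
    ‖y‖ < 2 := by
  have := norm_le_norm_add_norm_sub ξ y
  rw [mem_ball_iff_norm, norm_sub_rev] at hy
  linarith

theorem parabolicDilation_mem_ball {ξ : E} (hξ : ‖ξ‖ = 1) {r : ℝ} (h0 : 0 < r) (h1 : r ≤ 1) {y : E}
    (hy : y ∈ Metric.ball ξ 1) : parabolicDilation ξ r y ∈ Metric.ball ξ 1 := by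
  rw [mem_ball_unit_iff hξ] at hy ⊢
  rw [norm_parabolicDilation_sq hξ, inner_parabolicDilation hξ,
    show ((r : ℂ) ^ 2 * ⟪ξ, y⟫_ℂ).re = r ^ 2 * (⟪ξ, y⟫_ℂ).re by
      rw [← Complex.ofReal_pow, Complex.re_ofReal_mul]]
  have : r ^ 4 ≤ r ^ 2 := pow_le_pow_of_le_one h0.le h1 (by norm_num)
  nlinarith [mul_nonneg (sub_nonneg.2 this) (sq_nonneg ‖⟪ξ, y⟫_ℂ‖),
    mul_lt_mul_of_pos_left hy (pow_pos h0 2)]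

theorem ball_subset_iUnion_image_parabolicDilation {ξ : E} (hξ : ‖ξ‖ = 1) :
    Metric.ball ξ 1 ⊆ ⋃ k : ℕ, parabolicDilation ξ ((1 / 2 : ℝ) ^ k) ''
      (Metric.closedBall 0 3 ∩ {y | 1 / 2 < ‖⟪ξ, y⟫_ℂ‖}) := by
  intro y hy
  set u := ⟪ξ, y⟫_ℂ with hu
  have hu0 : 0 < ‖u‖ := norm_pos_iff.2 (inner_ne_zero_of_mem_ball hξ hy)
  have hu2 : ‖u‖ < 2 := (norm_inner_le_norm_of_unit hξ y).trans_lt (norm_lt_two_of_mem_ball hξ hy)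
  -- The exponent `k` is chosen with `4 ^ k ‖u‖ ≤ 2 < 4 ^ (k + 1) ‖u‖`: dilation by `2 ^ k` brings
  -- the inner product into `(1/2, 2]`, and the squared norm is then at most `4 + 4 < 9`.
  obtain ⟨k, hk1, hk2⟩ := exists_nat_pow_near (x := 2 / ‖u‖) (y := (4 : ℝ))
    (by rw [le_div_iff₀ hu0]; linarith) (by norm_num)
  rw [le_div_iff₀ hu0] at hk1
  rw [div_lt_iff₀ hu0, pow_succ] at hk2
  have h4 : ((2 : ℝ) ^ k) ^ 2 = 4 ^ k := by rw [← pow_mul, mul_comm, pow_mul]; norm_num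
  have hinv : ((1 / 2 : ℝ) ^ k)⁻¹ = 2 ^ k := by simp
  refine Set.mem_iUnion.2 ⟨k, parabolicDilation ξ (2 ^ k) y, ⟨?_, ?_⟩, ?_⟩
  · rw [mem_closedBall_zero_iff]
    refine (sq_le_sq₀ (norm_nonneg _) (by norm_num)).1 ?_
    rw [mem_ball_unit_iff hξ] at hy
    have hre : (⟪ξ, y⟫_ℂ).re ≤ ‖u‖ := Complex.re_le_norm _
    rw [norm_parabolicDilation_sq hξ, show (4 : ℕ) = 2 * 2 from rfl, pow_mul, h4, ← hu]
    have : (4 ^ k * ‖u‖) ^ 2 ≤ 2 ^ 2 := pow_le_pow_left₀ (by positivity) hk1 2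
    have h5 : (4 : ℝ) ^ k * ‖y‖ ^ 2 ≤ 4 ^ k * (2 * ‖u‖) := by
      gcongr; linarith
    nlinarith [sq_nonneg ‖u‖, pow_pos (show (0 : ℝ) < 4 by norm_num) k]
  · rw [Set.mem_ofPred_eq, inner_parabolicDilation hξ, norm_mul, norm_pow]
    push_cast
    rw [norm_pow, Complex.norm_ofNat, h4]
    linarith
  · rw [← hinv]
    exact parabolicDilation_inv_cancel hξ (by positivity) y

variable [FiniteDimensional ℂ E]

/-- The transvection has determinant `1 + (r - 1) = r`, the scalar contributes one `r` per
dimension, and the real determinant is the squared modulus of the complex one. -/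
theorem det_parabolicDilation {ξ : E} (hξ : ‖ξ‖ = 1) (r : ℝ) :
    LinearMap.det ((parabolicDilation ξ r).restrictScalars ℝ) = r ^ (2 * (finrank ℂ E + 1)) := by
  have : LinearMap.det (parabolicDilation ξ r) = (r : ℂ) ^ (finrank ℂ E + 1) := by
    rw [parabolicDilation, LinearMap.det_smul, LinearMap.transvection.det]
    simp [inner_self_eq_norm_sq_to_K, hξ, pow_succ]
  rw [LinearMap.det_restrictScalars, this, Algebra.norm_complex_apply, Complex.normSq_eq_norm_sq,
    norm_pow, Complex.norm_real, ← pow_mul, mul_comm, Real.norm_eq_abs, Even.pow_abs (by simp)]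

variable [MeasurableSpace E] [BorelSpace E] (μ : Measure E) [μ.IsAddHaarMeasure]

theorem setLIntegral_image_parabolicDilation {ξ : E} (hξ : ‖ξ‖ = 1) {r : ℝ} (hr : 0 < r)
    {S : Set E} (hS : MeasurableSet S) (g : E → ℝ≥0∞) :
    ∫⁻ y in parabolicDilation ξ r '' S, g y ∂μ =
      ENNReal.ofReal (r ^ (2 * (finrank ℂ E + 1))) * ∫⁻ y in S, g (parabolicDilation ξ r y) ∂μ := by
  have : FiniteDimensional ℝ E := FiniteDimensional.complexToReal E
  set A : E →L[ℝ] E := LinearMap.toContinuousLinearMap ((parabolicDilation ξ r).restrictScalars ℝ)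
  have hA : A.det = r ^ (2 * (finrank ℂ E + 1)) := by
    rw [← det_parabolicDilation hξ r]; rfl
  have := lintegral_image_eq_lintegral_abs_det_fderiv_mul μ hS (f := parabolicDilation ξ r)
    (f' := fun _ => A) (fun x _ => A.hasFDerivWithinAt)
    (parabolicDilation_injective hξ hr.ne').injOn g
  rw [this, hA, abs_of_nonneg (by positivity), lintegral_const_mul' _ _ ENNReal.ofReal_ne_top]

theorem setLIntegral_kernel_image_parabolicDilation {ξ : E} (hξ : ‖ξ‖ = 1) {r : ℝ} (hr : 0 < r)
    {S : Set E} (hS : MeasurableSet S) (t : ℝ) :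
    ∫⁻ y in parabolicDilation ξ r '' S, ‖⟪ξ, y⟫_ℂ‖ₑ ^ (-t) ∂μ =
      ENNReal.ofReal (r ^ (2 * ((finrank ℂ E : ℝ) + 1 - t))) *
        ∫⁻ y in S, ‖⟪ξ, y⟫_ℂ‖ₑ ^ (-t) ∂μ := by
  have h1 (y : E) : ‖⟪ξ, parabolicDilation ξ r y⟫_ℂ‖ₑ ^ (-t) =
      ENNReal.ofReal (r ^ (-(2 * t))) * ‖⟪ξ, y⟫_ℂ‖ₑ ^ (-t) := by
    rw [inner_parabolicDilation hξ, enorm_mul, ENNReal.mul_rpow_of_ne_top (by simp) (by simp)]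
    congr 1
    rw [← ofReal_norm, ENNReal.ofReal_rpow_of_pos (by simp; positivity)]
    congr 1
    rw [norm_pow, Complex.norm_real, Real.norm_of_nonneg hr.le, ← Real.rpow_natCast,
      ← Real.rpow_mul hr.le]
    congr 1
    push_cast
    ring
  rw [setLIntegral_image_parabolicDilation μ hξ hr hS]
  simp_rw [h1]
  rw [lintegral_const_mul' _ _ ENNReal.ofReal_ne_top, ← mul_assoc,
    ← ENNReal.ofReal_mul (by positivity), ← Real.rpow_natCast, ← Real.rpow_add hr]
  congr 4
  push_cast
  ring

theorem measurableSet_image_parabolicDilation {ξ : E} (hξ : ‖ξ‖ = 1) {r : ℝ} (hr : 0 < r)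
    {S : Set E} (hS : MeasurableSet S) : MeasurableSet (parabolicDilation ξ r '' S) := by
  have hc : Continuous (parabolicDilation ξ r) := LinearMap.continuous_of_finiteDimensional _
  exact hS.image_of_continuousOn_injOn hc.continuousOn
    (parabolicDilation_injective hξ hr.ne').injOn

/-- At the critical exponent the half-size dilate `A` of the ball `W` carries the same integral as
`W`, yet misses a nonempty open subset where the kernel is positive. A finite integral would be
contradictory. -/
theorem setLIntegral_kernel_ball_eq_top {ξ : E} (hξ : ‖ξ‖ = 1) :
    ∫⁻ y in Metric.ball ξ 1, ‖⟪ξ, y⟫_ℂ‖ₑ ^ (-((finrank ℂ E : ℝ) + 1)) ∂μ = ∞ := by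
  by_contra hfin
  set f : E → ℝ≥0∞ := fun y => ‖⟪ξ, y⟫_ℂ‖ₑ ^ (-((finrank ℂ E : ℝ) + 1)) with hf
  have hfm : Measurable f := by fun_prop
  set W := Metric.ball ξ 1
  set A := parabolicDilation ξ (1 / 2) '' W with hA
  have hAm : MeasurableSet A :=
    measurableSet_image_parabolicDilation hξ (by norm_num) measurableSet_ball
  have hAW : A ⊆ W := by
    rintro _ ⟨y, hy, rfl⟩
    exact parabolicDilation_mem_ball hξ (by norm_num) (by norm_num) hy
  have hint : ∫⁻ y in A, f y ∂μ = ∫⁻ y in W, f y ∂μ := by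
    rw [hA, hf, setLIntegral_kernel_image_parabolicDilation μ hξ (by norm_num) measurableSet_ball]
    simp [W]
  set V : Set E := W ∩ {y | 1 / 2 < ‖⟪ξ, y⟫_ℂ‖} with hV
  have hVo : IsOpen V := Metric.isOpen_ball.inter
    (isOpen_lt continuous_const (by fun_prop))
  -- On `A` the inner product is a quarter of one of modulus below `2`, hence below `1/2`.
  have hVA : Disjoint A V := by
    rw [Set.disjoint_left]
    rintro _ ⟨y, hy, rfl⟩ ⟨-, h⟩
    rw [Set.mem_ofPred_eq, inner_parabolicDilation hξ, norm_mul] at h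
    have h3 := norm_inner_le_norm_of_unit hξ y
    have h4 := norm_lt_two_of_mem_ball hξ hy
    norm_num at h
    linarith
  have hVne : V.Nonempty := ⟨ξ, by simp [W], by
    simp [inner_self_eq_norm_sq_to_K, hξ]; norm_num⟩
  have hsum : ∫⁻ y in A, f y ∂μ + ∫⁻ y in V, f y ∂μ ≤ ∫⁻ y in W, f y ∂μ := by
    rw [← lintegral_union hVo.measurableSet hVA]
    exact lintegral_mono_set (Set.union_subset hAW Set.inter_subset_left)
  rw [hint] at hsum
  have hz : ∫⁻ y in V, f y ∂μ = 0 := by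
    by_contra h
    exact (ENNReal.lt_add_right hfin h).not_ge hsum
  rw [lintegral_eq_zero_iff hfm, Filter.EventuallyEq, ae_restrict_iff' hVo.measurableSet] at hz
  have : μ V = 0 := by
    refine measure_mono_null (fun y hy => ?_) hz
    simp only [Set.mem_compl_iff, Set.mem_ofPred_eq, not_forall, hf]
    refine ⟨hy, ?_⟩
    rw [Pi.zero_apply, ENNReal.rpow_eq_zero_iff]
    rintro (⟨-, h⟩ | ⟨h, -⟩)
    · have : (0 : ℝ) ≤ finrank ℂ E := Nat.cast_nonneg _
      linarith
    · exact enorm_ne_top h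
  exact (hVo.measure_pos μ hVne).ne' this

theorem setLIntegral_kernel_inter_ball_eq_top {ξ : E} (hξ : ‖ξ‖ = 1) {ε : ℝ} (hε : 0 < ε) :
    ∫⁻ y in Metric.ball 0 ε ∩ Metric.ball ξ 1, ‖⟪ξ, y⟫_ℂ‖ₑ ^ (-((finrank ℂ E : ℝ) + 1)) ∂μ = ∞ := by
  -- Points of the ball about `ξ` have norm below `2`, so the dilate lies in the ball of radius `2 r
  -- ≤ ε`.
  set r : ℝ := min 1 (ε / 2) with hr
  have hr0 : 0 < r := by positivity
  rw [eq_top_iff]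
  calc ∞ = ∫⁻ y in parabolicDilation ξ r '' Metric.ball ξ 1,
        ‖⟪ξ, y⟫_ℂ‖ₑ ^ (-((finrank ℂ E : ℝ) + 1)) ∂μ := by
        rw [setLIntegral_kernel_image_parabolicDilation μ hξ hr0 measurableSet_ball,
          setLIntegral_kernel_ball_eq_top μ hξ]
        simp
    _ ≤ _ := lintegral_mono_set ?_
  rintro _ ⟨y, hy, rfl⟩
  refine ⟨?_, parabolicDilation_mem_ball hξ hr0 (min_le_left _ _) hy⟩
  rw [mem_ball_zero_iff]
  have h1 := norm_parabolicDilation_le hξ hr0.le (min_le_left _ _) y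
  have h2 := norm_lt_two_of_mem_ball hξ hy
  have h3 : r ≤ ε / 2 := min_le_right _ _
  nlinarith

/-- The ball is covered by dilates, of ratios `2 ^ (-k)`, of a bounded set on which the kernel is
bounded; their integrals decay geometrically. Uniformity in `ξ` is what allows peaks to be summed
later. -/
theorem exists_setLIntegral_kernel_ball_le {t : ℝ} (h0 : 0 ≤ t) (ht : t < (finrank ℂ E : ℝ) + 1) :
    ∃ M : ℝ≥0∞, M ≠ ∞ ∧ ∀ ξ : E, ‖ξ‖ = 1 →
      ∫⁻ y in Metric.ball ξ 1, ‖⟪ξ, y⟫_ℂ‖ₑ ^ (-t) ∂μ ≤ M := by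
  set s : ℝ := 2 * ((finrank ℂ E : ℝ) + 1 - t) with hs
  have hs0 : 0 < s := by linarith
  set ρ : ℝ≥0∞ := ENNReal.ofReal ((1 / 2 : ℝ) ^ s) with hρ
  have hρ1 : ρ < 1 := by
    rw [hρ, ENNReal.ofReal_lt_one]
    exact Real.rpow_lt_one (by norm_num) (by norm_num) hs0
  set C : ℝ≥0∞ := (ENNReal.ofReal (1 / 2)) ^ (-t) * μ (Metric.closedBall 0 3) with hC
  have : ProperSpace E := FiniteDimensional.proper ℂ E
  have hCfin : C ≠ ∞ := by
    refine ENNReal.mul_ne_top ?_ (isCompact_closedBall _ _).measure_lt_top.ne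
    rw [ENNReal.ofReal_rpow_of_pos (by norm_num)]
    exact ENNReal.ofReal_ne_top
  refine ⟨(1 - ρ)⁻¹ * C, ENNReal.mul_ne_top ?_ hCfin, fun ξ hξ => ?_⟩
  · simp [tsub_eq_zero_iff_le, hρ1]
  set S : Set E := Metric.closedBall 0 3 ∩ {y | 1 / 2 < ‖⟪ξ, y⟫_ℂ‖}
  have hSm : MeasurableSet S := measurableSet_closedBall.inter
    (measurableSet_lt measurable_const (by fun_prop))
  have hS : ∫⁻ y in S, ‖⟪ξ, y⟫_ℂ‖ₑ ^ (-t) ∂μ ≤ C := by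
    calc ∫⁻ y in S, ‖⟪ξ, y⟫_ℂ‖ₑ ^ (-t) ∂μ ≤ ∫⁻ y in S, (ENNReal.ofReal (1 / 2)) ^ (-t) ∂μ := by
          refine setLIntegral_mono' hSm fun y hy => ?_
          rw [ENNReal.rpow_neg, ENNReal.rpow_neg, ENNReal.inv_le_inv, ← ofReal_norm]
          refine ENNReal.rpow_le_rpow ?_ h0
          exact ENNReal.ofReal_le_ofReal hy.2.le
      _ ≤ C := by
          rw [setLIntegral_const]
          exact mul_le_mul' le_rfl (measure_mono Set.inter_subset_left)
  calc ∫⁻ y in Metric.ball ξ 1, ‖⟪ξ, y⟫_ℂ‖ₑ ^ (-t) ∂μ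
      ≤ ∫⁻ y in ⋃ k : ℕ, parabolicDilation ξ ((1 / 2 : ℝ) ^ k) '' S, ‖⟪ξ, y⟫_ℂ‖ₑ ^ (-t) ∂μ :=
        lintegral_mono_set (ball_subset_iUnion_image_parabolicDilation hξ)
    _ ≤ ∑' k : ℕ, ∫⁻ y in parabolicDilation ξ ((1 / 2 : ℝ) ^ k) '' S, ‖⟪ξ, y⟫_ℂ‖ₑ ^ (-t) ∂μ :=
        lintegral_iUnion_le _ _
    _ ≤ ∑' k : ℕ, ρ ^ k * C := by
        refine ENNReal.tsum_le_tsum fun k => ?_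
        rw [setLIntegral_kernel_image_parabolicDilation μ hξ (by positivity) hSm, ← hs, hρ,
          ← ENNReal.ofReal_pow (by positivity), ← Real.rpow_natCast, ← Real.rpow_natCast,
          ← Real.rpow_mul (by norm_num), ← Real.rpow_mul (by norm_num), mul_comm s]
        gcongr
    _ = (1 - ρ)⁻¹ * C := by rw [ENNReal.tsum_mul_right, ENNReal.tsum_geometric]

end ParabolicDilation

/-! ### Peak functions at a boundary point of the ball -/

section PeakFunctions

open Module
open scoped InnerProductSpace

/-- A logarithm is dominated by every negative power. Halving `u` keeps the modulus at most `1`, so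
the real part of the logarithm has constant sign. -/
theorem norm_log_half_le {a : ℝ} (ha : 0 < a) {u : ℂ} (h0 : 0 < ‖u‖) (h2 : ‖u‖ ≤ 2) :
    ‖Complex.log (u / 2)‖ ≤ (1 / a + Real.pi) * 2 ^ a * ‖u‖ ^ (-a) := by
  have hx : 1 ≤ 2 / ‖u‖ := by rw [le_div_iff₀ h0]; linarith
  have h1 : ‖Complex.log (u / 2)‖ ≤ Real.log (2 / ‖u‖) + Real.pi := by
    refine (Complex.norm_le_abs_re_add_abs_im _).trans ?_
    rw [Complex.log_re, Complex.log_im, norm_div, Complex.norm_ofNat, ← inv_div, Real.log_inv, abs_neg,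
      abs_of_nonneg (Real.log_nonneg hx)]
    gcongr
    exact Complex.abs_arg_le_pi _
  have h3 : Real.log (2 / ‖u‖) ≤ (2 / ‖u‖) ^ a / a := Real.log_le_rpow_div (by positivity) ha
  have h4 : 1 ≤ (2 / ‖u‖) ^ a := Real.one_le_rpow hx ha.le
  have h5 : (2 / ‖u‖) ^ a = 2 ^ a * ‖u‖ ^ (-a) := by
    rw [Real.div_rpow (by norm_num) h0.le, Real.rpow_neg h0.le, div_eq_mul_inv]
  calc ‖Complex.log (u / 2)‖ ≤ (2 / ‖u‖) ^ a / a + Real.pi * (2 / ‖u‖) ^ a := by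
        nlinarith [Real.pi_pos]
    _ = _ := by rw [mul_assoc, ← h5]; ring

variable {E : Type*} [NormedAddCommGroup E] [InnerProductSpace ℂ E]

theorem re_one_sub_inner_pos {ξ : E} (hξ : ‖ξ‖ = 1) {w : E} (hw : w ∈ Metric.ball 0 1) :
    0 < (1 - ⟪ξ, w⟫_ℂ).re := by
  rw [mem_ball_zero_iff] at hw
  have := (Complex.re_le_norm _).trans (norm_inner_le_norm_of_unit hξ w)
  rw [Complex.sub_re, Complex.one_re]
  linarith

theorem norm_one_sub_inner_le_two {ξ : E} (hξ : ‖ξ‖ = 1) {w : E} (hw : w ∈ Metric.ball 0 1) :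
    ‖1 - ⟪ξ, w⟫_ℂ‖ ≤ 2 := by
  rw [mem_ball_zero_iff] at hw
  have h1 := norm_inner_le_norm_of_unit hξ w
  have h2 := norm_sub_le (1 : ℂ) ⟪ξ, w⟫_ℂ
  rw [norm_one] at h2
  linarith

variable [FiniteDimensional ℂ E] [MeasurableSpace E] [BorelSpace E] (μ : Measure E)
  [μ.IsAddHaarMeasure]

theorem setLIntegral_one_sub_inner {ξ : E} (hξ : ‖ξ‖ = 1) (T : Set E) (F : ℂ → ℝ≥0∞) :
    ∫⁻ w in (fun w => ξ - w) ⁻¹' T, F (1 - ⟪ξ, w⟫_ℂ) ∂μ = ∫⁻ y in T, F ⟪ξ, y⟫_ℂ ∂μ := by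
  rw [← (Measure.measurePreserving_sub_left μ ξ).setLIntegral_comp_preimage_emb
    (MeasurableEquiv.subLeft ξ).measurableEmbedding (fun y => F ⟪ξ, y⟫_ℂ) T]
  simp [inner_self_eq_norm_sq_to_K, hξ]

theorem setLIntegral_kernel_peak_eq_top {ξ : E} (hξ : ‖ξ‖ = 1) {ε : ℝ} (hε : 0 < ε) :
    ∫⁻ w in Metric.ball ξ ε ∩ Metric.ball 0 1,
      ‖1 - ⟪ξ, w⟫_ℂ‖ₑ ^ (-((finrank ℂ E : ℝ) + 1)) ∂μ = ∞ := by
  rw [← setLIntegral_kernel_inter_ball_eq_top μ hξ hε,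
    ← setLIntegral_one_sub_inner μ hξ _ (fun u => ‖u‖ₑ ^ (-((finrank ℂ E : ℝ) + 1)))]
  congr 2
  ext w
  simp [dist_eq_norm, norm_sub_rev ξ w]

theorem exists_setLIntegral_kernel_unitBall_le {t : ℝ} (h0 : 0 ≤ t) (ht : t < (finrank ℂ E : ℝ) + 1) :
    ∃ M : ℝ≥0∞, M ≠ ∞ ∧ ∀ ξ : E, ‖ξ‖ = 1 →
      ∫⁻ w in Metric.ball 0 1, ‖1 - ⟪ξ, w⟫_ℂ‖ₑ ^ (-t) ∂μ ≤ M := by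
  obtain ⟨M, hM, h⟩ := exists_setLIntegral_kernel_ball_le μ h0 ht
  refine ⟨M, hM, fun ξ hξ => le_of_eq_of_le ?_ (h ξ hξ)⟩
  rw [← setLIntegral_one_sub_inner μ hξ _ (fun u => ‖u‖ₑ ^ (-t))]
  congr 2
  ext w
  simp [dist_eq_norm]

/-- A pointwise bound by a power of `|1 - ⟪ξ, w⟫|` below the critical exponent gives a bound of the
`L^p` norms which is uniform in the unit vector `ξ`. -/
theorem exists_eLpNorm_peak_le {φ : ℂ → ℂ} {p : ℝ≥0∞} (hp1 : 1 ≤ p) (hp : p ≠ ∞) {t : ℝ} (h0 : 0 ≤ t)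
    (ht : t < (finrank ℂ E : ℝ) + 1) {K : ℝ≥0∞} (hK : K ≠ ∞)
    (hφ : ∀ u : ℂ, 0 < u.re → ‖u‖ ≤ 2 → ‖φ u‖ₑ ^ p.toReal ≤ K * ‖u‖ₑ ^ (-t)) :
    ∃ M : ℝ≥0∞, M ≠ ∞ ∧ ∀ ξ : E, ‖ξ‖ = 1 →
      eLpNorm (fun w => φ (1 - ⟪ξ, w⟫_ℂ)) p (μ.restrict (Metric.ball 0 1)) ≤ M := by
  obtain ⟨M, hM, h⟩ := exists_setLIntegral_kernel_unitBall_le μ h0 ht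
  refine ⟨(K * M) ^ (1 / p.toReal),
    ENNReal.rpow_ne_top_of_nonneg (by positivity) (ENNReal.mul_ne_top hK hM), fun ξ hξ => ?_⟩
  rw [eLpNorm_eq_lintegral_rpow_enorm_toReal (zero_lt_one.trans_le hp1).ne' hp]
  refine ENNReal.rpow_le_rpow ?_ (by positivity)
  calc ∫⁻ w in Metric.ball 0 1, ‖φ (1 - ⟪ξ, w⟫_ℂ)‖ₑ ^ p.toReal ∂μ
      ≤ ∫⁻ w in Metric.ball 0 1, K * ‖1 - ⟪ξ, w⟫_ℂ‖ₑ ^ (-t) ∂μ :=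
        setLIntegral_mono' measurableSet_ball fun w hw =>
          hφ _ (re_one_sub_inner_pos hξ hw) (norm_one_sub_inner_le_two hξ hw)
    _ ≤ K * M := by
        rw [lintegral_const_mul' _ _ hK]
        gcongr
        exact h ξ hξ

theorem exists_peak_of_ne_top {q : ℝ≥0∞} (hq : 1 < q) (hqt : q ≠ ∞) :
    ∃ φ : ℂ → ℂ, DifferentiableOn ℂ φ {u | 0 < u.re} ∧
      (∀ p, 1 ≤ p → p < q → ∃ M : ℝ≥0∞, M ≠ ∞ ∧ ∀ ξ : E, ‖ξ‖ = 1 →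
        eLpNorm (fun w => φ (1 - ⟪ξ, w⟫_ℂ)) p (μ.restrict (Metric.ball 0 1)) ≤ M) ∧
      ∀ ξ : E, ‖ξ‖ = 1 → ∀ ε : ℝ, 0 < ε →
        eLpNorm (fun w => φ (1 - ⟪ξ, w⟫_ℂ)) q (μ.restrict (Metric.ball ξ ε ∩ Metric.ball 0 1)) = ∞ := by
  set N : ℝ := (finrank ℂ E : ℝ) + 1 with hN
  have hN0 : 0 < N := by positivity
  have hq0 : 0 < q.toReal := ENNReal.toReal_pos (zero_lt_one.trans hq).ne' hqt
  -- With this `s`, the `p`-th power of `|u ^ (-s)|` has exponent `-N p / q`, which is critical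
  -- exactly at `p = q`.
  set s : ℝ := N / q.toReal with hs
  have hφ (p : ℝ) {u : ℂ} (hu : 0 < u.re) : ‖u ^ ((-s : ℝ) : ℂ)‖ₑ ^ p = ‖u‖ₑ ^ (-(s * p)) := by
    have hu0 : 0 < ‖u‖ := hu.trans_le (Complex.re_le_norm u)
    rw [← ofReal_norm, Complex.norm_cpow_real, ← ENNReal.ofReal_rpow_of_pos hu0, ← ENNReal.rpow_mul,
      ofReal_norm, neg_mul]
  refine ⟨fun u => u ^ ((-s : ℝ) : ℂ), ?_, fun p hp1 hpq => ?_, fun ξ hξ ε hε => ?_⟩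
  · exact fun u hu => (DifferentiableAt.cpow_const differentiableAt_id
      (Or.inl hu)).differentiableWithinAt
  · have hp : p ≠ ∞ := (hpq.trans_le le_top).ne
    refine exists_eLpNorm_peak_le (E := E) (φ := fun u => u ^ ((-s : ℝ) : ℂ)) μ hp1 hp
      (t := s * p.toReal) (K := 1) (by positivity) ?_ ENNReal.one_ne_top fun u hu _ => ?_
    · rw [hs, div_mul_eq_mul_div, div_lt_iff₀ hq0]
      have := (ENNReal.toReal_lt_toReal hp hqt).2 hpq
      gcongr
    · rw [hφ _ hu, one_mul]
  · rw [eLpNorm_eq_lintegral_rpow_enorm_toReal (zero_lt_one.trans hq).ne' hqt,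
      setLIntegral_congr_fun (g := fun w => ‖1 - ⟪ξ, w⟫_ℂ‖ₑ ^ (-N))
        (measurableSet_ball.inter measurableSet_ball)
        (fun w hw => ?_), setLIntegral_kernel_peak_eq_top μ hξ hε]
    · exact ENNReal.top_rpow_of_pos (by positivity)
    · dsimp only
      rw [hφ _ (re_one_sub_inner_pos hξ hw.2), hs, div_mul_cancel₀ _ hq0.ne']

theorem exists_peak_top :
    ∃ φ : ℂ → ℂ, DifferentiableOn ℂ φ {u | 0 < u.re} ∧
      (∀ p : ℝ≥0∞, 1 ≤ p → p < ∞ → ∃ M : ℝ≥0∞, M ≠ ∞ ∧ ∀ ξ : E, ‖ξ‖ = 1 →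
        eLpNorm (fun w => φ (1 - ⟪ξ, w⟫_ℂ)) p (μ.restrict (Metric.ball 0 1)) ≤ M) ∧
      ∀ ξ : E, ‖ξ‖ = 1 → ∀ ε : ℝ, 0 < ε →
        eLpNorm (fun w => φ (1 - ⟪ξ, w⟫_ℂ)) ∞ (μ.restrict (Metric.ball ξ ε ∩ Metric.ball 0 1)) = ∞ := by
  refine ⟨fun u => Complex.log (u / 2), ?_, fun p hp1 hpq => ?_, fun ξ hξ ε hε => ?_⟩
  · intro u hu
    refine (DifferentiableAt.clog (by fun_prop) (Or.inl ?_)).differentiableWithinAt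
    rw [show (2 : ℂ) = ((2 : ℝ) : ℂ) by norm_num, Complex.div_ofReal_re]
    exact half_pos hu
  · have hp : p ≠ ∞ := hpq.ne
    have hp0 : 0 < p.toReal := ENNReal.toReal_pos (zero_lt_one.trans_le hp1).ne' hp
    -- This makes the `p`-th power of the logarithm at most a constant times `‖u‖ ^ (-1/2)`, safely
    -- subcritical in every dimension.
    set a : ℝ := 1 / (2 * p.toReal) with ha
    have ha0 : 0 < a := by positivity
    refine exists_eLpNorm_peak_le (E := E) (φ := fun u => Complex.log (u / 2)) μ hp1 hp (t := 1 / 2) (by norm_num) ?_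
      (K := ENNReal.ofReal (((1 / a + Real.pi) * 2 ^ a) ^ p.toReal)) ENNReal.ofReal_ne_top
      fun u hu hu2 => ?_
    · have : (0 : ℝ) ≤ finrank ℂ E := Nat.cast_nonneg _
      linarith
    · have hu0 : 0 < ‖u‖ := hu.trans_le (Complex.re_le_norm u)
      have hC : 0 < (1 / a + Real.pi) * 2 ^ a := by have := Real.pi_pos; positivity
      rw [← ofReal_norm, ← ofReal_norm, ENNReal.ofReal_rpow_of_pos hu0,
        ← ENNReal.ofReal_mul (by positivity),
        ENNReal.ofReal_rpow_of_nonneg (norm_nonneg _) hp0.le]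
      refine ENNReal.ofReal_le_ofReal ?_
      calc ‖Complex.log (u / 2)‖ ^ p.toReal
          ≤ ((1 / a + Real.pi) * 2 ^ a * ‖u‖ ^ (-a)) ^ p.toReal :=
            Real.rpow_le_rpow (norm_nonneg _) (norm_log_half_le ha0 hu0 hu2) hp0.le
        _ = _ := by
            rw [Real.mul_rpow hC.le (by positivity), ← Real.rpow_mul hu0.le]
            congr 2
            rw [ha]
            field_simp
  · by_contra hfin
    rw [eLpNorm_exponent_top] at hfin
    set C : ℝ := (eLpNormEssSup (fun w => Complex.log ((1 - ⟪ξ, w⟫_ℂ) / 2))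
      (μ.restrict (Metric.ball ξ ε ∩ Metric.ball 0 1))).toReal with hC
    have : ProperSpace E := FiniteDimensional.proper ℂ E
    have hm : μ (Metric.ball ξ ε ∩ Metric.ball 0 1) ≠ ∞ :=
      (measure_lt_top_of_subset Set.inter_subset_left measure_ball_lt_top.ne).ne
    -- An essential bound `C` on the logarithm forces `‖1 - ⟪ξ, w⟫‖ ≥ 2 exp (-C)` almost everywhere,
    -- so the critical kernel would be integrable near `ξ`.
    refine (?_ : ∫⁻ w in Metric.ball ξ ε ∩ Metric.ball 0 1,
      ‖1 - ⟪ξ, w⟫_ℂ‖ₑ ^ (-((finrank ℂ E : ℝ) + 1)) ∂μ < ∞).ne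
        (setLIntegral_kernel_peak_eq_top μ hξ hε)
    calc ∫⁻ w in Metric.ball ξ ε ∩ Metric.ball 0 1,
          ‖1 - ⟪ξ, w⟫_ℂ‖ₑ ^ (-((finrank ℂ E : ℝ) + 1)) ∂μ
        ≤ ∫⁻ w in Metric.ball ξ ε ∩ Metric.ball 0 1,
          ENNReal.ofReal (2 * Real.exp (-C)) ^ (-((finrank ℂ E : ℝ) + 1)) ∂μ := by
          refine lintegral_mono_ae ?_
          filter_upwards [ae_le_eLpNormEssSup (f := fun w => Complex.log ((1 - ⟪ξ, w⟫_ℂ) / 2))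
            (μ := μ.restrict (Metric.ball ξ ε ∩ Metric.ball 0 1)),
            ae_restrict_mem (measurableSet_ball.inter measurableSet_ball)] with w hw hwm
          have hu0 : 0 < ‖1 - ⟪ξ, w⟫_ℂ‖ :=
            (re_one_sub_inner_pos hξ hwm.2).trans_le (Complex.re_le_norm _)
          rw [ENNReal.rpow_neg, ENNReal.rpow_neg, ENNReal.inv_le_inv, ← ofReal_norm]
          refine ENNReal.rpow_le_rpow (ENNReal.ofReal_le_ofReal ?_) (by positivity)
          have h1 : ‖Complex.log ((1 - ⟪ξ, w⟫_ℂ) / 2)‖ ≤ C := by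
            rw [hC, ← toReal_enorm]
            exact ENNReal.toReal_mono hfin hw
          have h2 := (neg_le_abs _).trans ((Complex.abs_re_le_norm _).trans h1)
          rw [Complex.log_re, norm_div, Complex.norm_ofNat, neg_le,
            Real.le_log_iff_exp_le (by positivity)] at h2
          linarith
      _ < ∞ := by
          rw [setLIntegral_const]
          refine ENNReal.mul_lt_top ?_ hm.lt_top
          rw [ENNReal.ofReal_rpow_of_pos (by positivity)]
          exact ENNReal.ofReal_lt_top

theorem exists_peak {q : ℝ≥0∞} (hq : 1 < q) :
    ∃ φ : ℂ → ℂ, DifferentiableOn ℂ φ {u | 0 < u.re} ∧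
      (∀ p, 1 ≤ p → p < q → ∃ M : ℝ≥0∞, M ≠ ∞ ∧ ∀ ξ : E, ‖ξ‖ = 1 →
        eLpNorm (fun w => φ (1 - ⟪ξ, w⟫_ℂ)) p (μ.restrict (Metric.ball 0 1)) ≤ M) ∧
      ∀ ξ : E, ‖ξ‖ = 1 → ∀ ε : ℝ, 0 < ε →
        eLpNorm (fun w => φ (1 - ⟪ξ, w⟫_ℂ)) q (μ.restrict (Metric.ball ξ ε ∩ Metric.ball 0 1)) = ∞ := by
  rcases eq_or_ne q ∞ with rfl | hqt
  · exact exists_peak_top μ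
  · exact exists_peak_of_ne_top μ hq hqt

end PeakFunctions

/-! ### Superposition of peaks and Baire's theorem for the coefficients -/

section PeakSeries

open Module
open scoped InnerProductSpace

variable {E : Type*} [NormedAddCommGroup E] [InnerProductSpace ℂ E]

/-- The superposition `∑ c_k 2^{-k-1} φ(1 - ⟪ξ_k, w⟫)` with coefficients `c_k ∈ [0, 1]`. -/
noncomputable def peakSeries (φ : ℂ → ℂ) (ξ : ℕ → E) (c : ℕ → unitInterval) (w : E) : ℂ :=
  ∑' k, (((c k : ℝ) * (1 / 2) ^ (k + 1) : ℝ) : ℂ) * φ (1 - ⟪ξ k, w⟫_ℂ)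

theorem summable_half_pow_succ : Summable fun k : ℕ => (1 / 2 : ℝ) ^ (k + 1) :=
  (summable_nat_add_iff 1).2 summable_geometric_two

theorem norm_coeff_le (c : ℕ → unitInterval) (k : ℕ) :
    ‖(((c k : ℝ) * (1 / 2) ^ (k + 1) : ℝ) : ℂ)‖ ≤ (1 / 2) ^ (k + 1) := by
  rw [Complex.norm_real, norm_mul, norm_pow, Real.norm_of_nonneg (c k).2.1]
  rw [Real.norm_of_nonneg (by norm_num : (0 : ℝ) ≤ 1 / 2)]
  exact mul_le_of_le_one_left (by positivity) (c k).2.2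

/-- For `‖w‖ < ρ` the argument stays in the closed disc of radius `ρ` about `1`, a compact subset of
the half-plane. The bound does not depend on `ξ`. -/
theorem exists_norm_peak_le {φ : ℂ → ℂ} (hφ : ContinuousOn φ {u | 0 < u.re}) {ρ : ℝ} (hρ : ρ < 1) :
    ∃ K : ℝ, ∀ ξ : E, ‖ξ‖ = 1 → ∀ w ∈ Metric.ball (0 : E) ρ, ‖φ (1 - ⟪ξ, w⟫_ℂ)‖ ≤ K := by
  have hsub : Metric.closedBall (1 : ℂ) ρ ⊆ {u | 0 < u.re} := by
    intro u hu
    rw [mem_closedBall_iff_norm'] at hu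
    have h := (Complex.re_le_norm _).trans hu
    rw [Complex.sub_re, Complex.one_re] at h
    change 0 < u.re
    linarith
  obtain ⟨K, hK⟩ := (isCompact_closedBall (1 : ℂ) ρ).exists_bound_of_continuousOn (hφ.mono hsub)
  refine ⟨K, fun ξ hξ w hw => hK _ ?_⟩
  rw [mem_ball_zero_iff] at hw
  rw [mem_closedBall_iff_norm]
  simpa using (norm_inner_le_norm_of_unit hξ w).trans hw.le

theorem summable_peakSeries {φ : ℂ → ℂ} (hφ : ContinuousOn φ {u | 0 < u.re}) {ξ : ℕ → E}
    (hξ : ∀ k, ‖ξ k‖ = 1) (c : ℕ → unitInterval) {w : E} (hw : w ∈ Metric.ball 0 1) :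
    Summable fun k => (((c k : ℝ) * (1 / 2) ^ (k + 1) : ℝ) : ℂ) * φ (1 - ⟪ξ k, w⟫_ℂ) := by
  rw [mem_ball_zero_iff] at hw
  obtain ⟨ρ, h1, h2⟩ := exists_between hw
  obtain ⟨K, hK⟩ := exists_norm_peak_le (E := E) hφ h2
  refine Summable.of_norm_bounded (summable_half_pow_succ.mul_right K) fun k => ?_
  rw [norm_mul]
  exact mul_le_mul (norm_coeff_le c k) (hK _ (hξ k) w (by simpa using h1)) (norm_nonneg _)
    (by positivity)

theorem continuous_peakSeries_coeff {φ : ℂ → ℂ} (hφ : ContinuousOn φ {u | 0 < u.re}) {ξ : ℕ → E}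
    (hξ : ∀ k, ‖ξ k‖ = 1) {w : E} (hw : w ∈ Metric.ball 0 1) :
    Continuous fun c : ℕ → unitInterval => peakSeries φ ξ c w := by
  rw [mem_ball_zero_iff] at hw
  obtain ⟨ρ, h1, h2⟩ := exists_between hw
  obtain ⟨K, hK⟩ := exists_norm_peak_le (E := E) hφ h2
  refine continuous_tsum (fun k => by fun_prop) (summable_half_pow_succ.mul_right K) fun k c => ?_
  rw [norm_mul]
  exact mul_le_mul (norm_coeff_le c k) (hK _ (hξ k) w (by simpa using h1)) (norm_nonneg _)
    (by positivity)

theorem hasFDerivAt_peak {φ : ℂ → ℂ} (hφ : DifferentiableOn ℂ φ {u | 0 < u.re}) {ξ : E}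
    (hξ : ‖ξ‖ = 1) {w : E} (hw : w ∈ Metric.ball 0 1) :
    HasFDerivAt (fun w => φ (1 - ⟪ξ, w⟫_ℂ)) (deriv φ (1 - ⟪ξ, w⟫_ℂ) • -(innerSL ℂ ξ)) w := by
  have ho : IsOpen {u : ℂ | 0 < u.re} := isOpen_lt continuous_const Complex.continuous_re
  have h1 := (hφ.differentiableAt (ho.mem_nhds (re_one_sub_inner_pos hξ hw))).hasDerivAt
  exact h1.comp_hasFDerivAt w ((innerSL ℂ ξ).hasFDerivAt.const_sub 1)

theorem differentiableOn_peakSeries {φ : ℂ → ℂ} (hφ : DifferentiableOn ℂ φ {u | 0 < u.re}) {ξ : ℕ → E}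
    (hξ : ∀ k, ‖ξ k‖ = 1) (c : ℕ → unitInterval) :
    DifferentiableOn ℂ (peakSeries φ ξ c) (Metric.ball 0 1) := by
  have ho : IsOpen {u : ℂ | 0 < u.re} := isOpen_lt continuous_const Complex.continuous_re
  intro w hw
  have hw' := hw
  rw [mem_ball_zero_iff] at hw'
  obtain ⟨ρ, h1, h2⟩ := exists_between hw'
  obtain ⟨K, hK⟩ := exists_norm_peak_le (E := E) (hφ.deriv ho).continuousOn h2
  have hwρ : w ∈ Metric.ball (0 : E) ρ := by simpa using h1
  have h0ρ : (0 : E) ∈ Metric.ball (0 : E) ρ := by simpa using (norm_nonneg w).trans_lt h1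
  refine (hasFDerivAt_tsum_of_isPreconnected (𝕜 := ℂ) (s := Metric.ball 0 ρ)
    (f' := fun k x => (((c k : ℝ) * (1 / 2) ^ (k + 1) : ℝ) : ℂ) •
      (deriv φ (1 - ⟪ξ k, x⟫_ℂ) • -(innerSL ℂ (ξ k))))
    (summable_half_pow_succ.mul_right K) Metric.isOpen_ball ?_ (fun k x hx => ?_)
    (fun k x hx => ?_) h0ρ ?_ hwρ).differentiableAt.differentiableWithinAt
  · let _ : NormedSpace ℝ E := NormedSpace.complexToReal
    exact (convex_ball (0 : E) ρ).isPreconnected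
  · exact (hasFDerivAt_peak hφ (hξ k) (Metric.ball_subset_ball h2.le hx)).const_mul _
  · rw [norm_smul, norm_smul, norm_neg, innerSL_apply_norm, hξ k, mul_one]
    exact mul_le_mul (norm_coeff_le c k) (hK _ (hξ k) x hx) (norm_nonneg _) (by positivity)
  · exact summable_peakSeries hφ.continuousOn hξ c (by simp)

theorem peakSeries_sub_peakSeries_update {φ : ℂ → ℂ} (hφ : ContinuousOn φ {u | 0 < u.re}) {ξ : ℕ → E}
    (hξ : ∀ k, ‖ξ k‖ = 1) (c : ℕ → unitInterval) (k : ℕ) (t : unitInterval) {w : E}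
    (hw : w ∈ Metric.ball 0 1) :
    peakSeries φ ξ c w - peakSeries φ ξ (Function.update c k t) w =
      ((((c k : ℝ) - t) * (1 / 2) ^ (k + 1) : ℝ) : ℂ) * φ (1 - ⟪ξ k, w⟫_ℂ) := by
  rw [peakSeries, peakSeries, ← (summable_peakSeries hφ hξ c hw).tsum_sub
    (summable_peakSeries hφ hξ _ hw), tsum_eq_single k fun j hj => by
      rw [Function.update_of_ne hj, sub_self], Function.update_self]
  push_cast
  ring

variable [MeasurableSpace E] [BorelSpace E] (μ : Measure E)

theorem aestronglyMeasurable_peak {φ : ℂ → ℂ} (hφ : ContinuousOn φ {u | 0 < u.re}) {ξ : E} (hξ : ‖ξ‖ = 1) :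
    AEStronglyMeasurable (fun w => φ (1 - ⟪ξ, w⟫_ℂ)) (μ.restrict (Metric.ball 0 1)) :=
  (hφ.comp (by fun_prop) fun _ hw => re_one_sub_inner_pos hξ hw).aestronglyMeasurable
    measurableSet_ball

theorem aestronglyMeasurable_peakSeries {φ : ℂ → ℂ} (hφ : DifferentiableOn ℂ φ {u | 0 < u.re})
    {ξ : ℕ → E} (hξ : ∀ k, ‖ξ k‖ = 1) (c : ℕ → unitInterval) :
    AEStronglyMeasurable (peakSeries φ ξ c) (μ.restrict (Metric.ball 0 1)) :=
  (differentiableOn_peakSeries hφ hξ c).continuousOn.aestronglyMeasurable measurableSet_ball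

/-- Minkowski for the partial sums, whose weights total at most `1`, then Fatou. -/
theorem eLpNorm_peakSeries_le {φ : ℂ → ℂ} (hφ : ContinuousOn φ {u | 0 < u.re}) {ξ : ℕ → E}
    (hξ : ∀ k, ‖ξ k‖ = 1) (c : ℕ → unitInterval) {p : ℝ≥0∞} (hp : 1 ≤ p) {M : ℝ≥0∞}
    (hM : ∀ k, eLpNorm (fun w => φ (1 - ⟪ξ k, w⟫_ℂ)) p (μ.restrict (Metric.ball 0 1)) ≤ M) :
    eLpNorm (peakSeries φ ξ c) p (μ.restrict (Metric.ball 0 1)) ≤ M := by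
  set f : ℕ → E → ℂ := fun k =>
    (((c k : ℝ) * (1 / 2) ^ (k + 1) : ℝ) : ℂ) • fun w => φ (1 - ⟪ξ k, w⟫_ℂ) with hf
  have hfm (k : ℕ) : AEStronglyMeasurable (f k) (μ.restrict (Metric.ball 0 1)) :=
    (aestronglyMeasurable_peak μ hφ (hξ k)).const_smul _
  refine (Lp.eLpNorm_lim_le_liminf_eLpNorm (f := fun n => ∑ k ∈ Finset.range n, f k)
    (fun n => Finset.aestronglyMeasurable_sum _ fun k _ => hfm k) _ ?_).trans
    (liminf_le_of_frequently_le' (Frequently.of_forall fun n => ?_))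
  · filter_upwards [ae_restrict_mem measurableSet_ball] with w hw
    simpa [hf, peakSeries] using (summable_peakSeries hφ hξ c hw).hasSum.tendsto_sum_nat
  · calc eLpNorm (∑ k ∈ Finset.range n, f k) p (μ.restrict (Metric.ball 0 1))
        ≤ ∑ k ∈ Finset.range n, eLpNorm (f k) p (μ.restrict (Metric.ball 0 1)) :=
          eLpNorm_sum_le (fun k _ => hfm k) hp
      _ ≤ ∑ k ∈ Finset.range n, ENNReal.ofReal ((1 / 2) ^ (k + 1)) * M := by
          refine Finset.sum_le_sum fun k _ => ?_
          rw [hf, eLpNorm_const_smul, ← ofReal_norm]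
          exact mul_le_mul' (ENNReal.ofReal_le_ofReal (norm_coeff_le c k)) (hM k)
      _ ≤ 1 * M := by
          rw [← Finset.sum_mul, ← ENNReal.ofReal_sum_of_nonneg fun _ _ => by positivity]
          gcongr
          rw [ENNReal.ofReal_le_one]
          refine (summable_half_pow_succ.sum_le_tsum _ fun _ _ => by positivity).trans_eq ?_
          simp_rw [pow_succ]
          rw [tsum_mul_right, tsum_geometric_two]
          norm_num
      _ = M := one_mul M

theorem isClosed_eLpNorm_peakSeries_le {φ : ℂ → ℂ} (hφ : DifferentiableOn ℂ φ {u | 0 < u.re})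
    {ξ : ℕ → E} (hξ : ∀ k, ‖ξ k‖ = 1) (q : ℝ≥0∞) (U : Set E) (hU : U ⊆ Metric.ball 0 1)
    (hUm : MeasurableSet U) (m : ℝ≥0∞) :
    IsClosed {c | eLpNorm (peakSeries φ ξ c) q (μ.restrict U) ≤ m} := by
  refine IsSeqClosed.isClosed fun c c₀ hc hlim => ?_
  refine (Lp.eLpNorm_lim_le_liminf_eLpNorm (f := fun n => peakSeries φ ξ (c n))
    (fun n => (aestronglyMeasurable_peakSeries μ hφ hξ _).mono_measure
      (Measure.restrict_mono hU le_rfl)) _ ?_).trans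
    (liminf_le_of_frequently_le' (Frequently.of_forall hc))
  filter_upwards [ae_restrict_mem hUm] with w hw
  exact ((continuous_peakSeries_coeff hφ.continuousOn hξ (hU hw)).tendsto c₀).comp hlim

/-- By Baire's theorem on the cube of coefficients, some superposition of countably many peaks has
infinite `L^q` norm near each of them. -/
theorem exists_peakSeries_eLpNorm_eq_top {φ : ℂ → ℂ} (hφ : DifferentiableOn ℂ φ {u | 0 < u.re})
    {ξ : ℕ → E} (hξ : ∀ k, ‖ξ k‖ = 1) {q : ℝ≥0∞} (hq : 1 ≤ q)
    (hinf : ∀ k, ∀ ε : ℝ, 0 < ε → eLpNorm (fun w => φ (1 - ⟪ξ k, w⟫_ℂ)) q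
      (μ.restrict (Metric.ball (ξ k) ε ∩ Metric.ball 0 1)) = ∞) :
    ∃ c : ℕ → unitInterval, ∀ k l : ℕ, eLpNorm (peakSeries φ ξ c) q
      (μ.restrict (Metric.ball (ξ k) (1 / ((l : ℝ) + 1)) ∩ Metric.ball 0 1)) = ∞ := by
  by_contra! hcon
  set U : ℕ → ℕ → Set E := fun k l => Metric.ball (ξ k) (1 / ((l : ℝ) + 1)) ∩ Metric.ball 0 1 with hU
  have hUb (k l : ℕ) : U k l ⊆ Metric.ball 0 1 := Set.inter_subset_right
  have hUm (k l : ℕ) : MeasurableSet (U k l) := measurableSet_ball.inter measurableSet_ball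
  obtain ⟨⟨k, l, m⟩, c, hc⟩ := nonempty_interior_of_iUnion_of_closed
    (f := fun i : ℕ × ℕ × ℕ =>
      {c : ℕ → unitInterval | eLpNorm (peakSeries φ ξ c) q (μ.restrict (U i.1 i.2.1)) ≤ i.2.2})
    (fun i => isClosed_eLpNorm_peakSeries_le μ hφ hξ q _ (hUb _ _) (hUm _ _) _) (by
      refine Set.eq_univ_of_forall fun c => ?_
      obtain ⟨k, l, hkl⟩ := hcon c
      obtain ⟨m, hm⟩ := ENNReal.exists_nat_gt hkl
      exact Set.mem_iUnion.2 ⟨(k, l, m), hm.le⟩)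
  have hcont : Tendsto (fun t => Function.update c k t) (𝓝[≠] (c k)) (𝓝 c) := by
    have : Continuous fun t => Function.update c k t := by fun_prop
    have h := this.tendsto (c k)
    rw [Function.update_eq_self] at h
    exact h.mono_left nhdsWithin_le_nhds
  -- Interior points of a sublevel set stay in it when the `k`-th coefficient alone is moved
  -- slightly. The difference of the two series is a nonzero multiple of the single peak at `ξ k`,
  -- whose local norm is infinite.
  obtain ⟨t, ht, htne⟩ :=
    ((hcont.eventually (mem_interior_iff_mem_nhds.1 hc)).and self_mem_nhdsWithin).exists
  have hcm := interior_subset hc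
  simp only [Set.mem_ofPred_eq] at hcm ht
  set a : ℂ := ((((c k : ℝ) - t) * (1 / 2) ^ (k + 1) : ℝ) : ℂ) with ha
  have ha0 : a ≠ 0 := by
    rw [ha, Complex.ofReal_ne_zero]
    refine mul_ne_zero (sub_ne_zero.2 fun h => htne (Subtype.ext h.symm)) (by positivity)
  have hmeas (c : ℕ → unitInterval) :
      AEStronglyMeasurable (peakSeries φ ξ c) (μ.restrict (U k l)) :=
    (aestronglyMeasurable_peakSeries μ hφ hξ _).mono_measure (Measure.restrict_mono (hUb _ _) le_rfl)
  have h1 : eLpNorm (a • fun w => φ (1 - ⟪ξ k, w⟫_ℂ)) q (μ.restrict (U k l)) < ∞ := by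
    refine lt_of_le_of_lt (le_of_eq_of_le (eLpNorm_congr_ae ?_)
      ((eLpNorm_sub_le (hmeas c) (hmeas (Function.update c k t)) hq).trans (add_le_add hcm ht)))
      (by simp)
    filter_upwards [ae_restrict_mem (hUm k l)] with w hw
    exact (peakSeries_sub_peakSeries_update hφ.continuousOn hξ c k t (hUb _ _ hw)).symm
  rw [eLpNorm_const_smul, hinf k _ (by positivity), ENNReal.mul_top (by simpa using ha0)] at h1
  exact h1.ne rfl

theorem exists_differentiableOn_eLpNorm_eq_top [FiniteDimensional ℂ E] [μ.IsAddHaarMeasure] {q : ℝ≥0∞} (hq : 1 < q) :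
    ∃ H : E → ℂ, DifferentiableOn ℂ H (Metric.ball 0 1) ∧
      (∀ p, 1 ≤ p → p < q → eLpNorm H p (μ.restrict (Metric.ball 0 1)) < ∞) ∧
      ∀ ξ : E, ‖ξ‖ = 1 → ∀ ε : ℝ, 0 < ε →
        eLpNorm H q (μ.restrict (Metric.ball ξ ε ∩ Metric.ball 0 1)) = ∞ := by
  rcases (Metric.sphere (0 : E) 1).eq_empty_or_nonempty with hemp | hne
  -- In dimension zero the sphere is empty and the singularity condition is vacuous.
  · refine ⟨0, differentiableOn_const 0, fun p _ _ => by simp, fun ξ hξ => ?_⟩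
    exact absurd (mem_sphere_zero_iff_norm.2 hξ) (by simp [hemp])
  have : Nonempty (Metric.sphere (0 : E) 1) := hne.to_subtype
  have : ProperSpace E := FiniteDimensional.proper ℂ E
  set ξ : ℕ → E := fun k => (denseSeq (Metric.sphere (0 : E) 1) k : E)
  have hξ (k : ℕ) : ‖ξ k‖ = 1 := 
    mem_sphere_zero_iff_norm.1 (denseSeq (Metric.sphere (0 : E) 1) k).2
  obtain ⟨φ, hφ, hfin, hinf⟩ := exists_peak μ hq
  obtain ⟨c, hc⟩ := exists_peakSeries_eLpNorm_eq_top μ hφ hξ hq.le fun k => hinf (ξ k) (hξ k)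
  refine ⟨peakSeries φ ξ c, differentiableOn_peakSeries hφ hξ c, fun p h1 hp => ?_,
    fun η hη ε hε => ?_⟩
  · obtain ⟨M, hM, h⟩ := hfin p h1 hp
    exact (eLpNorm_peakSeries_le μ hφ.continuousOn hξ c h1 fun k => h _ (hξ k)).trans_lt hM.lt_top
  · obtain ⟨l, hl⟩ := exists_nat_one_div_lt (half_pos hε)
    obtain ⟨k, hk⟩ := (denseRange_denseSeq (Metric.sphere (0 : E) 1)).exists_dist_lt
      ⟨η, mem_sphere_zero_iff_norm.2 hη⟩ (half_pos hε)
    rw [eq_top_iff, ← hc k l]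
    refine eLpNorm_mono_measure _ (Measure.restrict_mono (Set.inter_subset_inter_left _
      (Metric.ball_subset_ball' ?_)) le_rfl)
    rw [Subtype.dist_eq, dist_comm] at hk
    change dist (ξ k) η < _ at hk
    linarith

end PeakSeries

/-! ### Transfer to linear preimages of the ball -/

section LinearPullback

variable {E : Type*} [NormedAddCommGroup E]

theorem norm_eq_one_of_mem_frontier_preimage_ball [NormedSpace ℂ E] (L : E ≃L[ℂ] E) {ζ : E}
    (hζ : ζ ∈ frontier (L ⁻¹' Metric.ball 0 1)) : ‖L ζ‖ = 1 := by
  have h : L ⁻¹' Metric.ball 0 1 = {z | ‖L z‖ < 1} := by ext; simp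
  rw [h] at hζ
  exact frontier_lt_subset_eq (f := fun z => ‖L z‖) (g := fun _ => (1 : ℝ)) L.continuous.norm
    continuous_const hζ

variable [MeasurableSpace E] [BorelSpace E]

theorem eLpNorm_comp_continuousLinearEquiv [NormedSpace ℂ E] (μ : Measure E) (L : E ≃L[ℂ] E)
    (H : E → ℂ) (p : ℝ≥0∞) (T : Set E) :
    eLpNorm (H ∘ L) p (μ.restrict (L ⁻¹' T)) = eLpNorm H p ((Measure.map L μ).restrict T) := by
  set e : E ≃ᵐ E := L.toHomeomorph.toMeasurableEquiv
  have h : (Measure.map L μ).restrict T = Measure.map L (μ.restrict (L ⁻¹' T)) :=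
    e.restrict_map μ T
  rw [h]
  exact (e.measurableEmbedding.eLpNorm_map_measure).symm

theorem exists_differentiableOn_preimage_ball [InnerProductSpace ℂ E] [FiniteDimensional ℂ E]
    (μ : Measure E) [μ.IsAddHaarMeasure] {q : ℝ≥0∞} (hq : 1 < q) (L : E ≃L[ℂ] E) :
    ∃ g : E → ℂ, DifferentiableOn ℂ g (L ⁻¹' Metric.ball 0 1) ∧
      (∀ p, 1 ≤ p → p < q → eLpNorm g p (μ.restrict (L ⁻¹' Metric.ball 0 1)) < ∞) ∧
      ∀ ζ ∈ frontier (L ⁻¹' Metric.ball 0 1), ∀ ε : ℝ, 0 < ε →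
        eLpNorm g q (μ.restrict (Metric.ball ζ ε ∩ L ⁻¹' Metric.ball 0 1)) = ∞ := by
  -- Applying the ball case to the pushed-forward Haar measure makes all norms correspond exactly,
  -- with no Jacobian factor.
  have : (Measure.map L μ).IsAddHaarMeasure := L.isAddHaarMeasure_map μ
  obtain ⟨H, hH, hfin, hinf⟩ := exists_differentiableOn_eLpNorm_eq_top (Measure.map L μ) hq
  refine ⟨H ∘ L, hH.comp L.differentiable.differentiableOn fun _ h => h, fun p h1 hp => ?_,
    fun ζ hζ ε hε => ?_⟩
  · rw [eLpNorm_comp_continuousLinearEquiv]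
    exact hfin p h1 hp
  · have hcont : Tendsto L.symm (𝓝 (L ζ)) (𝓝 ζ) := by
      simpa using L.symm.continuous.tendsto (L ζ)
    obtain ⟨δ, hδ, hsub⟩ := Metric.mem_nhds_iff.1 (hcont (Metric.ball_mem_nhds ζ hε))
    rw [eq_top_iff, ← hinf (L ζ) (norm_eq_one_of_mem_frontier_preimage_ball L hζ) δ hδ,
      ← eLpNorm_comp_continuousLinearEquiv]
    have hsub' : L ⁻¹' (Metric.ball (L ζ) δ ∩ Metric.ball 0 1) ⊆
        Metric.ball ζ ε ∩ L ⁻¹' Metric.ball 0 1 := fun z hz => ⟨by simpa using hsub hz.1, hz.2⟩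
    exact eLpNorm_mono_measure _ (Measure.restrict_mono hsub' le_rfl)

end LinearPullback

/-! ### Local `L^q` norms, lower semicontinuity and density in the Bergman intersection -/

section BergmanSpace

variable {n : ℕ}

/-- The linear change of coordinates `z_j ↦ z_j / a_j`. -/
noncomputable def coordinateScaling (a : Fin n → ℝ) (ha : ∀ j, 0 < a j) : Cn n ≃L[ℂ] Cn n :=
  LinearEquiv.toContinuousLinearEquiv
    { toFun := fun z => WithLp.toLp 2 fun j => z j / (a j : ℂ)
      invFun := fun z => WithLp.toLp 2 fun j => z j * (a j : ℂ)
      map_add' := fun x y => by ext j; simp [add_div]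
      map_smul' := fun c x => by ext j; simp [mul_div_assoc]
      left_inv := fun x => by
        ext j
        simp [div_mul_cancel₀ _ (Complex.ofReal_ne_zero.2 (ha j).ne')]
      right_inv := fun x => by
        ext j
        simp [mul_div_cancel_right₀ _ (Complex.ofReal_ne_zero.2 (ha j).ne')] }

theorem coordinateScaling_apply (a : Fin n → ℝ) (ha : ∀ j, 0 < a j) (z : Cn n) (j : Fin n) :
    coordinateScaling a ha z j = z j / (a j : ℂ) := rfl

theorem ellipsoid_eq_preimage (a : Fin n → ℝ) (ha : ∀ j, 0 < a j) :
    (ellipsoid a : Set (Cn n)) = coordinateScaling a ha ⁻¹' Metric.ball 0 1 := by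
  ext z
  rw [Set.mem_preimage, mem_ball_zero_iff, ← sq_lt_sq₀ (norm_nonneg _) zero_le_one,
    EuclideanSpace.norm_sq_eq, one_pow]
  simp only [coordinateScaling_apply, norm_div, Complex.norm_real, div_pow, Real.norm_eq_abs, sq_abs]
  rfl

/-- The case `p = ∞` needs an argument: the set where `‖f‖` exceeds its essential supremum is open
and null, hence empty. -/
theorem olNorm_eq_eLpNorm_of_continuousOn {p : ℝ≥0∞} (h0 : p ≠ 0) {U : Set (Cn n)} (hU : IsOpen U)
    {f : Cn n → ℂ} (hf : ContinuousOn f U) : olNorm p U f = eLpNorm f p (volume.restrict U) := by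
  by_cases hp : p = ∞
  · subst hp
    rw [olNorm, if_pos rfl, eLpNorm_exponent_top]
    refine le_antisymm (iSup₂_le fun z hz => ?_) ?_
    · by_contra! hlt
      set V := U ∩ (fun z => ‖f z‖ₑ) ⁻¹' Set.Ioi (eLpNormEssSup f (volume.restrict U))
      have hV : IsOpen V := hf.enorm.isOpen_inter_preimage hU isOpen_Ioi
      refine (hV.measure_pos volume ⟨z, hz, hlt⟩).ne' ?_
      have h := ae_le_eLpNormEssSup (f := f) (μ := volume.restrict U)
      rw [ae_restrict_iff' hU.measurableSet] at h
      refine measure_mono_null (fun x hx => ?_) h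
      rw [Set.mem_compl_iff, Set.mem_ofPred_eq]
      exact fun h' => (h' hx.1).not_gt hx.2
    · refine essSup_le_of_ae_le _ ?_
      filter_upwards [ae_restrict_mem hU.measurableSet] with z hz
      exact le_iSup₂ (f := fun z (_ : z ∈ U) => ‖f z‖ₑ) z hz
  · exact olNorm_eq_eLpNorm h0 hp U f

namespace BergmanInter

variable {Ω : Opens (Cn n)} {q : ℝ≥0∞}

theorem differentiableOn (hq : 1 < q) (f : BergmanInter Ω q) : DifferentiableOn ℂ f.1 Ω :=
  (f.2.2 1 le_rfl hq).1

theorem aestronglyMeasurable_restrict (hq : 1 < q) (f : BergmanInter Ω q) {U : Set (Cn n)}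
    (hU : U ⊆ Ω) : AEStronglyMeasurable f.1 (volume.restrict U) :=
  (f.aesm hq).mono_measure (Measure.restrict_mono hU le_rfl)

/-- The element `f + η g`. -/
noncomputable def addSMul (hq : 1 < q) (f g : BergmanInter Ω q) (η : ℝ) : BergmanInter Ω q :=
  ⟨f.1 + (η : ℂ) • g.1, fun z hz => by simp [f.2.1 z hz, g.2.1 z hz], fun p h1 hp =>
    ⟨(f.differentiableOn hq).add ((g.differentiableOn hq).const_smul _), by
      rw [olNorm_eq_eLpNorm (zero_lt_one.trans_le h1).ne' (hp.trans_le le_top).ne]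
      exact ((f.memLp h1 hp).add ((g.memLp h1 hp).const_smul _)).2⟩⟩

/-- By convexity the only component of `B(w, δ) ∩ Ω` is the whole set, and a bounded function on
this set of finite measure would have finite `L^q` norm. -/
theorem mem_unboundedSingularSet_of_eLpNorm_eq_top (hq : 1 < q) (hΩ : Convex ℝ (Ω : Set (Cn n)))
    {g : BergmanInter Ω q} (h : ∀ ζ ∈ frontier (Ω : Set (Cn n)), ∀ ε : ℝ, 0 < ε →
      eLpNorm g.1 q (volume.restrict (Metric.ball ζ ε ∩ Ω)) = ∞) :
    g ∈ unboundedSingularSet Ω q := by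
  have hO (ζ : Cn n) (ε : ℝ) : IsOpen (Metric.ball ζ ε ∩ (Ω : Set (Cn n))) :=
    Metric.isOpen_ball.inter Ω.isOpen
  refine ⟨fun w hw δ hδ z hz hb => ?_, fun ζ hζ ε hε hmem => ?_⟩
  · rw [((convex_ball w δ).inter hΩ).isPreconnected.connectedComponentIn hz] at hb
    obtain ⟨C, hC⟩ := hb
    have hfin : volume (Metric.ball w δ ∩ (Ω : Set (Cn n))) < ∞ :=
      measure_lt_top_of_subset Set.inter_subset_left measure_ball_lt_top.ne
    have : IsFiniteMeasure (volume.restrict (Metric.ball w δ ∩ (Ω : Set (Cn n)))) :=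
      ⟨by simpa using hfin⟩
    refine (MemLp.of_bound (p := q)
      (g.aestronglyMeasurable_restrict hq Set.inter_subset_right) C ?_).2.ne (h w hw δ hδ)
    filter_upwards [ae_restrict_mem (hO w δ).measurableSet] with x hx
    exact hC (Set.mem_image_of_mem _ hx)
  · refine hmem.2.ne ?_
    rw [olNorm_eq_eLpNorm_of_continuousOn (zero_lt_one.trans hq).ne' (hO ζ ε)
      ((g.differentiableOn hq).continuousOn.mono Set.inter_subset_right), h ζ hζ ε hε]

theorem eLpNorm_eq_top_of_mem_unboundedSingularSet (hq : 1 < q) {g : BergmanInter Ω q}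
    (hg : g ∈ unboundedSingularSet Ω q) {ζ : Cn n} (hζ : ζ ∈ frontier (Ω : Set (Cn n))) {ε : ℝ}
    (hε : 0 < ε) : eLpNorm g.1 q (volume.restrict (Metric.ball ζ ε ∩ Ω)) = ∞ := by
  by_contra hfin
  have hd : DifferentiableOn ℂ g.1 (Metric.ball ζ ε ∩ (Ω : Set (Cn n))) :=
    (g.differentiableOn hq).mono Set.inter_subset_right
  refine hg.2 ζ hζ ε hε ⟨hd, ?_⟩
  rw [olNorm_eq_eLpNorm_of_continuousOn (zero_lt_one.trans hq).ne'
    (Metric.isOpen_ball.inter Ω.isOpen) hd.continuousOn]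
  exact lt_top_iff_ne_top.2 hfin

theorem mem_unboundedSingularSet_iff (hq : 1 < q) (hΩ : Convex ℝ (Ω : Set (Cn n))) {ζ : ℕ → Cn n}
    (hζ : ∀ k, ζ k ∈ frontier (Ω : Set (Cn n)))
    (hdense : ∀ w ∈ frontier (Ω : Set (Cn n)), ∀ ε : ℝ, 0 < ε → ∃ k, dist (ζ k) w < ε)
    {g : BergmanInter Ω q} :
    g ∈ unboundedSingularSet Ω q ↔ ∀ k l : ℕ,
      eLpNorm g.1 q (volume.restrict (Metric.ball (ζ k) (1 / ((l : ℝ) + 1)) ∩ Ω)) = ∞ := by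
  refine ⟨fun hg k l => eLpNorm_eq_top_of_mem_unboundedSingularSet hq hg (hζ k) (by positivity),
    fun h => mem_unboundedSingularSet_of_eLpNorm_eq_top hq hΩ fun w hw ε hε => ?_⟩
  obtain ⟨l, hl⟩ := exists_nat_one_div_lt (half_pos hε)
  obtain ⟨k, hk⟩ := hdense w hw _ (half_pos hε)
  rw [eq_top_iff, ← h k l]
  refine eLpNorm_mono_measure _ (Measure.restrict_mono (Set.inter_subset_inter_left _
    (Metric.ball_subset_ball' ?_)) le_rfl)
  linarith

variable {p : ℕ → ℝ≥0∞}

theorem tendsto_eLpNorm_sub (hp : IsExponentSeq q p) {g : ℕ → BergmanInter Ω q}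
    {g₀ : BergmanInter Ω q}
    (h : Tendsto (fun i => bergmanDist Ω p (g i).1 g₀.1) atTop (𝓝 0)) (j : ℕ) :
    Tendsto (fun i => eLpNorm ((g i).1 - g₀.1) (p j) (volume.restrict (Ω : Set (Cn n)))) atTop
      (𝓝 0) := by
  set x : ℕ → ℝ := fun i => (olNorm (p j) Ω ((g i).1 - g₀.1)).toReal with hx
  have hterm : Tendsto (fun i => bergmanTerm Ω (p j) (g i).1 g₀.1) atTop (𝓝 0) := by
    refine squeeze_zero (fun i => bergmanTerm_nonneg ..) (fun i => ?_)
      (by simpa using h.const_mul ((2 : ℝ) ^ (j + 1)))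
    have h1 := (bergmanDist_summable Ω p (g i).1 g₀.1).le_tsum j fun k _ =>
      mul_nonneg (by positivity) (bergmanTerm_nonneg ..)
    calc bergmanTerm Ω (p j) (g i).1 g₀.1
        = 2 ^ (j + 1) * ((1 / 2 : ℝ) ^ (j + 1) * bergmanTerm Ω (p j) (g i).1 g₀.1) := by
          rw [← mul_assoc, ← mul_pow]; norm_num
      _ ≤ _ := mul_le_mul_of_nonneg_left h1 (by positivity)
  have hx0 : Tendsto x atTop (𝓝 0) := by
    -- The norm `x` is recovered from `s = x / (1 + x)` as `s / (1 - s)`.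
    have h1 := hterm.div (tendsto_const_nhds.sub hterm : Tendsto _ _ (𝓝 ((1 : ℝ) - 0))) (by simp)
    rw [zero_div] at h1
    refine h1.congr fun i => ?_
    have : 0 ≤ x i := ENNReal.toReal_nonneg
    have h2 : (1 : ℝ) + x i ≠ 0 := by positivity
    simp only [Pi.div_apply, bergmanTerm]
    change x i / (1 + x i) / (1 - x i / (1 + x i)) = x i
    field_simp
    ring
  have h2 := ENNReal.tendsto_ofReal hx0
  rw [ENNReal.ofReal_zero] at h2
  refine h2.congr fun i => ?_
  have hpt : p j ≠ ∞ := ((hp.lt j).trans_le le_top).ne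
  rw [hx]
  dsimp only
  rw [olNorm_eq_eLpNorm (zero_lt_one.trans (hp.one_lt j)).ne' hpt, ENNReal.ofReal_toReal]
  exact (((g i).memLp (hp.one_lt j).le (hp.lt j)).sub (g₀.memLp (hp.one_lt j).le (hp.lt j))).2.ne

theorem isClosed_eLpNorm_le (hq : 1 < q) (hp : IsExponentSeq q p) {U : Set (Cn n)} (hU : U ⊆ Ω)
    (m : ℝ≥0∞) :
    letI : MetricSpace (BergmanInter Ω q) := BergmanInter.metric Ω hp
    IsClosed {g : BergmanInter Ω q | eLpNorm g.1 q (volume.restrict U) ≤ m} := by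
  let _ : MetricSpace (BergmanInter Ω q) := BergmanInter.metric Ω hp
  refine IsSeqClosed.isClosed fun g g₀ hg hlim => ?_
  -- One exponent is enough: convergence in `L^{p 0}` yields an almost everywhere convergent
  -- subsequence, to which Fatou applies with exponent `q`.
  have h1 := tendsto_eLpNorm_sub hp (tendsto_iff_dist_tendsto_zero.1 hlim) 0
  obtain ⟨s, -, hs⟩ := (tendstoInMeasure_of_tendsto_eLpNorm (zero_lt_one.trans (hp.one_lt 0)).ne'
    (fun i => (g i).aesm hq) (g₀.aesm hq) h1).exists_seq_tendsto_ae
  exact (Lp.eLpNorm_lim_le_liminf_eLpNorm (f := fun i => (g (s i)).1)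
    (fun i => (g (s i)).aestronglyMeasurable_restrict hq hU) _
    (ae_mono (Measure.restrict_mono hU le_rfl) hs)).trans
    (liminf_le_of_frequently_le' (Frequently.of_forall fun i => hg (s i)))

theorem tendsto_addSMul (hq : 1 < q) (hp : IsExponentSeq q p) (f g : BergmanInter Ω q) :
    letI : MetricSpace (BergmanInter Ω q) := BergmanInter.metric Ω hp
    Tendsto (addSMul hq f g) (𝓝 0) (𝓝 f) := by
  let _ : MetricSpace (BergmanInter Ω q) := BergmanInter.metric Ω hp
  rw [tendsto_iff_dist_tendsto_zero]
  have hterm (η : ℝ) (j : ℕ) : bergmanTerm Ω (p j) (addSMul hq f g η).1 f.1 =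
      |η| * (olNorm (p j) Ω g.1).toReal / (1 + |η| * (olNorm (p j) Ω g.1).toReal) := by
    have hpt : p j ≠ ∞ := ((hp.lt j).trans_le le_top).ne
    have h0 : p j ≠ 0 := (zero_lt_one.trans (hp.one_lt j)).ne'
    rw [bergmanTerm, addSMul, add_sub_cancel_left, olNorm_eq_eLpNorm h0 hpt, eLpNorm_const_smul,
      olNorm_eq_eLpNorm h0 hpt, ENNReal.toReal_mul, toReal_enorm, Complex.norm_real,
      Real.norm_eq_abs]
  change Tendsto (fun η => ∑' j : ℕ, (1 / 2 : ℝ) ^ (j + 1) *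
    bergmanTerm Ω (p j) (addSMul hq f g η).1 f.1) (𝓝 0) (𝓝 0)
  have h := tendsto_tsum_of_dominated_convergence (𝓕 := 𝓝 (0 : ℝ)) (g := fun _ : ℕ => (0 : ℝ))
    (f := fun η j => (1 / 2 : ℝ) ^ (j + 1) * bergmanTerm Ω (p j) (addSMul hq f g η).1 f.1)
    summable_half_pow_succ (fun j => ?_) (Eventually.of_forall fun η j => ?_)
  · simpa using h
  · simp_rw [hterm]
    have : ContinuousAt (fun η : ℝ => (1 / 2 : ℝ) ^ (j + 1) * (|η| * (olNorm (p j) Ω g.1).toReal /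
        (1 + |η| * (olNorm (p j) Ω g.1).toReal))) 0 := by
      refine ContinuousAt.mul continuousAt_const (ContinuousAt.div (by fun_prop) (by fun_prop) ?_)
      simp
    simpa [ContinuousAt] using this
  · rw [Real.norm_of_nonneg (mul_nonneg (by positivity) (bergmanTerm_nonneg ..)), hterm]
    refine mul_le_of_le_one_right (by positivity) ?_
    rw [div_le_one (by positivity)]
    linarith

/-- Subtracting two members of the family with finite norm leaves a nonzero multiple of `g`. -/
theorem subsingleton_eLpNorm_addSMul_ne_top (hq : 1 < q) (f g : BergmanInter Ω q)
    {U : Set (Cn n)} (hU : U ⊆ Ω) (hg : eLpNorm g.1 q (volume.restrict U) = ∞) :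
    {η : ℝ | eLpNorm (addSMul hq f g η).1 q (volume.restrict U) ≠ ∞}.Subsingleton := by
  intro η hη θ hθ
  by_contra hne
  have h := eLpNorm_sub_le ((addSMul hq f g η).aestronglyMeasurable_restrict hq hU)
    ((addSMul hq f g θ).aestronglyMeasurable_restrict hq hU) hq.le
  rw [show (addSMul hq f g η).1 - (addSMul hq f g θ).1 = ((η - θ : ℝ) : ℂ) • g.1 by
    simp only [addSMul]; push_cast; rw [sub_smul]; abel, eLpNorm_const_smul, hg,
    ENNReal.mul_top (by simpa [sub_eq_zero] using hne), top_le_iff] at h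
  exact ENNReal.add_ne_top.2 ⟨hη, hθ⟩ h

theorem dense_isGδ_unboundedSingularSet (hq : 1 < q) (hp : IsExponentSeq q p)
    (hΩ : Convex ℝ (Ω : Set (Cn n))) {g₀ : BergmanInter Ω q} (hg₀ : g₀ ∈ unboundedSingularSet Ω q) :
    letI : MetricSpace (BergmanInter Ω q) := BergmanInter.metric Ω hp
    Dense (unboundedSingularSet Ω q) ∧ IsGδ (unboundedSingularSet Ω q) := by
  let _ : MetricSpace (BergmanInter Ω q) := BergmanInter.metric Ω hp
  rcases (frontier (Ω : Set (Cn n))).eq_empty_or_nonempty with hemp | hne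
  · have : unboundedSingularSet Ω q = Set.univ := Set.eq_univ_of_forall fun g =>
      mem_unboundedSingularSet_of_eLpNorm_eq_top hq hΩ (by simp [hemp])
    rw [this]
    exact ⟨dense_univ, IsGδ.univ⟩
  have : Nonempty (frontier (Ω : Set (Cn n))) := hne.to_subtype
  set ζ : ℕ → Cn n := fun k => (denseSeq (frontier (Ω : Set (Cn n))) k : Cn n)
  have hmem (g : BergmanInter Ω q) := mem_unboundedSingularSet_iff hq hΩ (ζ := ζ) (g := g)
    (fun k => (denseSeq (frontier (Ω : Set (Cn n))) k).2) (fun w hw ε hε => by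
      obtain ⟨k, hk⟩ := (denseRange_denseSeq (frontier (Ω : Set (Cn n)))).exists_dist_lt ⟨w, hw⟩ hε
      rw [Subtype.dist_eq, dist_comm] at hk
      exact ⟨k, hk⟩)
  set U : ℕ → ℕ → Set (Cn n) := fun k l => Metric.ball (ζ k) (1 / ((l : ℝ) + 1)) ∩ Ω
  have hU (k l : ℕ) : U k l ⊆ Ω := Set.inter_subset_right
  constructor
  · intro f
    -- The excluded parameters form a countable set, whose complement in `ℝ` accumulates at `0`.
    have hbad : (⋃ k, ⋃ l,
        {η : ℝ | eLpNorm (addSMul hq f g₀ η).1 q (volume.restrict (U k l)) ≠ ∞}).Countable :=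
      Set.countable_iUnion fun k => Set.countable_iUnion fun l =>
        (subsingleton_eLpNorm_addSMul_ne_top hq f g₀ (hU k l) ((hmem g₀).1 hg₀ k l)).countable
    refine mem_closure_iff_frequently.2 ((tendsto_addSMul hq hp f g₀).frequently
      ((mem_closure_iff_frequently.1 (hbad.dense_compl ℝ 0)).mono fun η hη => ?_))
    refine (hmem _).2 fun k l => ?_
    by_contra h
    exact hη (Set.mem_iUnion₂.2 ⟨k, l, h⟩)
  · have : unboundedSingularSet Ω q = ⋂ i : ℕ × ℕ × ℕ,
        {g : BergmanInter Ω q | eLpNorm g.1 q (volume.restrict (U i.1 i.2.1)) ≤ i.2.2}ᶜ := by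
      ext g
      rw [hmem g]
      simp only [Set.mem_iInter, Set.mem_compl_iff, Set.mem_ofPred_eq, not_le, Prod.forall]
      refine forall₂_congr fun k l => ⟨fun h m => ?_, fun h => ?_⟩
      · rw [h]
        exact ENNReal.natCast_lt_top m
      · by_contra hfin
        obtain ⟨m, hm⟩ := ENNReal.exists_nat_gt hfin
        exact (h m).not_gt hm
    rw [this]
    exact IsGδ.iInter_of_isOpen fun i => (isClosed_eLpNorm_le hq hp (hU _ _) _).isOpen_compl

theorem exists_mem_unboundedSingularSet (hq : 1 < q) (L : Cn n ≃L[ℂ] Cn n)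
    (hΩ : (Ω : Set (Cn n)) = L ⁻¹' Metric.ball 0 1) (hconv : Convex ℝ (Ω : Set (Cn n))) :
    ∃ g : BergmanInter Ω q, g ∈ unboundedSingularSet Ω q := by
  obtain ⟨g, hd, hfin, hinf⟩ := exists_differentiableOn_preimage_ball volume hq L
  rw [← hΩ] at hd hfin hinf
  -- Elements of the space must vanish off `Ω`; the cut-off changes no norm taken inside `Ω`.
  set G : Cn n → ℂ := (Ω : Set (Cn n)).indicator g
  have hG : Set.EqOn G g Ω := fun z hz => Set.indicator_of_mem hz g
  have hnorm (p : ℝ≥0∞) {U : Set (Cn n)} (hU : U ⊆ Ω) (hUm : MeasurableSet U) :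
      eLpNorm G p (volume.restrict U) = eLpNorm g p (volume.restrict U) :=
    eLpNorm_congr_ae (by
      filter_upwards [ae_restrict_mem hUm] with z hz
      exact hG (hU hz))
  refine ⟨⟨G, fun z hz => Set.indicator_of_notMem hz g, fun p h1 hp => ⟨hd.congr hG, ?_⟩⟩,
    mem_unboundedSingularSet_of_eLpNorm_eq_top hq hconv fun ζ hζ ε hε => ?_⟩
  · rw [olNorm_eq_eLpNorm (zero_lt_one.trans_le h1).ne' (hp.trans_le le_top).ne,
      hnorm p subset_rfl Ω.isOpen.measurableSet]
    exact hfin p h1 hp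
  · exact (hnorm q Set.inter_subset_right
      (measurableSet_ball.inter Ω.isOpen.measurableSet)).trans (hinf ζ hζ ε hε)

end BergmanInter

end BergmanSpace

theorem theorem12 (n : ℕ) (q : ℝ≥0∞) (hq : 1 < q) (Ω : Opens (Cn n))
    (hΩ : Ω = unitBall n ∨ ∃ a : Fin n → ℝ, (∀ j, 0 < a j) ∧ Ω = ellipsoid a)
    (p : ℕ → ℝ≥0∞) (hp : IsExponentSeq q p) :
    letI : MetricSpace (BergmanInter Ω q) := BergmanInter.metric Ω hp
    Dense (unboundedSingularSet Ω q) ∧ IsGδ (unboundedSingularSet Ω q) := by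
  obtain ⟨L, hL⟩ : ∃ L : Cn n ≃L[ℂ] Cn n, (Ω : Set (Cn n)) = L ⁻¹' Metric.ball 0 1 := by
    rcases hΩ with rfl | ⟨a, ha, rfl⟩
    · exact ⟨ContinuousLinearEquiv.refl ℂ _, rfl⟩
    · exact ⟨coordinateScaling a ha, ellipsoid_eq_preimage a ha⟩
  have hconv : Convex ℝ (Ω : Set (Cn n)) := by
    rw [hL]
    exact (convex_ball (0 : Cn n) 1).linear_preimage (L.toLinearMap.restrictScalars ℝ)
  obtain ⟨g, hg⟩ := BergmanInter.exists_mem_unboundedSingularSet hq L hL hconv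
  exact BergmanInter.dense_isGδ_unboundedSingularSet hq hp hconv hg
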